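/- Let $\mathbb{K}$ be a field, let $Q=(Q_0,Q_1;s,t)$ be a finite quiver (finitely many vertices and arrows; oriented cycles are allowed), and let $G$ be a finite group acting on $Q$ by quiver automorphisms. Let $\mathbb{K}Q$ be the path algebra, with basis all paths (including the trivial ones) and multiplication given by concatenation, written from right to left. Let $\overline{Q}$ be the double quiver, obtained from $Q$ by adding for each arrow $\alpha\colon i\to j$ an inverse arrow $\alpha^*\colon j\to i$, and let $$\Pi(Q)=\mathbb{K}\overline{Q}\Big/\Big(\sum_{\alpha\in Q_1}(\alpha\alpha^*-\alpha^*\alpha)\Big)$$ be the preprojective algebra of $Q$. The group $G$ acts by algebra automorphisms on $\mathbb{K}Q$, and on $\Pi(Q)$ through $g(\alpha^*)=g(\alpha)^*$. For an algebra $A$ with a $G$-action, the skew group algebra $A\#G=A\otimes\mathbb{K}G$ has multiplication $(a\#g)(b\#h)=a\,g(b)\#gh$. For a $\mathbb{K}$-algebra $A$ with enveloping algebra $A^e=A\otimes_{\mathbb{K}}A^{\rm op}$, the $2$-preprojective algebra of $A$ is the tensor algebra $$\Pi_2(A)=T_A\big({\rm Ext}^1_{A^e}(A,A^e)\big)$$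 of the $A$-$A$-bimodule ${\rm Ext}^1_{A^e}(A,A^e)$, whose bimodule structure is induced by the inner bimodule structure $a(x\otimes y)b=xb\otimes ay$ of $A^e$. Then there is an isomorphism of $\mathbb{K}$-algebras $$\Pi(Q)\#G\;\simeq\;\Pi_2(\mathbb{K}Q\#G).$$ -/

import Mathlib

open CategoryTheory MulOpposite
open scoped TensorProduct

universe u v w x

noncomputable section

/-! ### Group actions on quivers -/

/-- An action of a group `G` on a quiver `V` by quiver automorphisms: every `g` acts by a morphism
of quivers `V ⥤q V`, functorially in `g` (so that `act g` is invertible, with inverse `act g⁻¹`).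
Here `⋙q` is composition of quiver morphisms in diagrammatic order. -/
class QuiverAction (G : Type x) (V : Type v) [Group G] [Quiver.{w} V] where
  act : G → (V ⥤q V)
  act_one : act 1 = 𝟭q V
  act_mul : ∀ g h : G, act (g * h) = act h ⋙q act g

/-- The double quiver of `V` is Mathlib's `Quiver.Symmetrify V`: an arrow `Sum.inl α : a ⟶ b` and
an inverse arrow `α^* = Sum.inr α : b ⟶ a` for each arrow `α : a ⟶ b` of `V`. An action on `V`
induces one on the double quiver, by `g (α^*) = (g α)^*`. -/
instance QuiverAction.symmetrify (G : Type x) (V : Type v) [Group G] [Quiver.{w} V]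
    [QuiverAction G V] : QuiverAction G (Quiver.Symmetrify V) where
  act g := (QuiverAction.act g : V ⥤q V).symmetrify
  act_one := by
    rw [QuiverAction.act_one]
    refine Prefunctor.ext (fun _ => rfl) ?_
    rintro X Y (f | f) <;> rfl
  act_mul g h := by
    rw [QuiverAction.act_mul]
    refine Prefunctor.ext (fun _ => rfl) ?_
    rintro X Y (f | f) <;> rfl

instance (V : Type v) [Fintype V] : Fintype (Quiver.Symmetrify V) := inferInstanceAs (Fintype V)

/-- The set of all arrows of a quiver. -/
structure QuiverArrow (V : Type v) [Quiver.{w} V] where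
  src : V
  tgt : V
  arrow : src ⟶ tgt

/-- The set of all paths of a quiver (including the trivial ones). -/
structure QuiverPath (V : Type v) [Quiver.{w} V] where
  src : V
  tgt : V
  path : Quiver.Path src tgt

def QuiverArrow.equivSigma (V : Type v) [Quiver.{w} V] :
    QuiverArrow V ≃ Σ a b : V, (a ⟶ b) where
  toFun α := ⟨α.src, α.tgt, α.arrow⟩
  invFun α := ⟨α.1, α.2.1, α.2.2⟩
  left_inv _ := rfl
  right_inv _ := rfl

instance (V : Type v) [Quiver.{w} V] [Fintype V] [∀ a b : V, Fintype (a ⟶ b)] :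
    Fintype (QuiverArrow V) :=
  Fintype.ofEquiv _ (QuiverArrow.equivSigma V).symm

instance QuiverArrow.mulAction (G : Type x) (V : Type v) [Group G] [Quiver.{w} V]
    [QuiverAction G V] : MulAction G (QuiverArrow V) where
  smul g α := ⟨_, _, (QuiverAction.act g).map α.arrow⟩
  one_smul α := by
    change QuiverArrow.mk _ _ ((QuiverAction.act (1 : G)).map α.arrow) = α
    rw [QuiverAction.act_one]; rfl
  mul_smul g h α := by
    change QuiverArrow.mk _ _ ((QuiverAction.act (g * h)).map α.arrow) = _
    rw [QuiverAction.act_mul]; rfl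

/-- An arrow `α : a ⟶ b`, as an arrow of the double quiver. -/
def QuiverArrow.toDouble {V : Type v} [Quiver.{w} V] (α : QuiverArrow V) :
    QuiverArrow (Quiver.Symmetrify V) :=
  ⟨α.src, α.tgt, Quiver.Hom.toPos α.arrow⟩

/-- The inverse arrow `α^* : b ⟶ a` of `α : a ⟶ b` in the double quiver. -/
def QuiverArrow.star {V : Type v} [Quiver.{w} V] (α : QuiverArrow V) :
    QuiverArrow (Quiver.Symmetrify V) :=
  ⟨α.tgt, α.src, Quiver.Hom.toNeg α.arrow⟩

theorem QuiverArrow.smul_toDouble {G : Type x} {V : Type v} [Group G] [Quiver.{w} V]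
    [QuiverAction G V] (g : G) (α : QuiverArrow V) : g • α.toDouble = (g • α).toDouble := rfl

theorem QuiverArrow.smul_star {G : Type x} {V : Type v} [Group G] [Quiver.{w} V]
    [QuiverAction G V] (g : G) (α : QuiverArrow V) : g • α.star = (g • α).star := rfl

instance QuiverPath.mulAction (G : Type x) (V : Type v) [Group G] [Quiver.{w} V]
    [QuiverAction G V] : MulAction G (QuiverPath V) where
  smul g p := ⟨_, _, (QuiverAction.act g).mapPath p.path⟩
  one_smul p := by
    change QuiverPath.mk _ _ ((QuiverAction.act (1 : G)).mapPath p.path) = p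
    rw [QuiverAction.act_one, Prefunctor.mapPath_id]; rfl
  mul_smul g h p := by
    change QuiverPath.mk _ _ ((QuiverAction.act (g * h)).mapPath p.path) = _
    rw [QuiverAction.act_mul, Prefunctor.mapPath_comp_apply]; rfl

/-! ### Path algebras -/

/-- The path algebra `KQ`: the free `K`-module on the set of all paths. -/
def PathAlgebra (K : Type u) (V : Type v) [CommRing K] [Quiver.{w} V] : Type (max u v w) :=
  QuiverPath V →₀ K

namespace PathAlgebra

section

variable (K : Type u) {V : Type v} [CommRing K] [Quiver.{w} V]

instance : AddCommGroup (PathAlgebra K V) := inferInstanceAs (AddCommGroup (QuiverPath V →₀ K))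

instance : Module K (PathAlgebra K V) := inferInstanceAs (Module K (QuiverPath V →₀ K))

/-- The basis element of the path algebra given by a path. -/
def ofPath (p : QuiverPath V) : PathAlgebra K V := Finsupp.single p 1

/-- The element of the path algebra given by an arrow, a path of length one. -/
def ofArrow (α : QuiverArrow V) : PathAlgebra K V := ofPath K ⟨α.src, α.tgt, α.arrow.toPath⟩

open Classical in
/-- Concatenation of paths, written from right to left: `p q` is the path that runs through `q`
first and then through `p`, and it is zero if `q` does not end where `p` starts. -/
def pathMul (p q : QuiverPath V) : PathAlgebra K V :=
  if h : q.tgt = p.src then ofPath K ⟨q.src, p.tgt, q.path.comp (p.path.cast h.symm rfl)⟩ else 0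

variable {K}

theorem hom_ext {M : Type*} [AddCommGroup M] [Module K M] {f g : PathAlgebra K V →ₗ[K] M}
    (h : ∀ p, f (ofPath K p) = g (ofPath K p)) : f = g :=
  Finsupp.lhom_ext' fun p => LinearMap.ext_ring (h p)

variable (K V) in
/-- The bilinear extension of the concatenation of paths. -/
def mulLin : PathAlgebra K V →ₗ[K] PathAlgebra K V →ₗ[K] PathAlgebra K V :=
  Finsupp.lift (PathAlgebra K V →ₗ[K] PathAlgebra K V) K (QuiverPath V) fun p =>
    Finsupp.lift (PathAlgebra K V) K (QuiverPath V) fun q => pathMul K p q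

theorem mulLin_ofPath (p q : QuiverPath V) :
    mulLin K V (ofPath K p) (ofPath K q) = pathMul K p q := by
  have h : mulLin K V (ofPath K p) =
      Finsupp.lift (PathAlgebra K V) K (QuiverPath V) (fun q => pathMul K p q) := by
    refine (Finsupp.lift_apply _ _ _ _ _).trans ?_
    exact (Finsupp.sum_single_index (a := p) (b := (1 : K)) (zero_smul K _)).trans (one_smul K _)
  rw [h]
  refine (Finsupp.lift_apply _ _ _ _ _).trans ?_
  exact (Finsupp.sum_single_index (a := q) (b := (1 : K)) (zero_smul K _)).trans (one_smul K _)

theorem pathMul_of_eq {a b c : V} (p : Quiver.Path b c) (q : Quiver.Path a b) :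
    pathMul K ⟨b, c, p⟩ ⟨a, b, q⟩ = ofPath K ⟨a, c, q.comp p⟩ := by
  simp [pathMul]

theorem pathMul_of_ne {p q : QuiverPath V} (h : q.tgt ≠ p.src) : pathMul K p q = 0 := by
  simp [pathMul, h]

theorem mulLin_assoc (x y z : PathAlgebra K V) :
    mulLin K V (mulLin K V x y) z = mulLin K V x (mulLin K V y z) := by
  have key : ∀ p q r : QuiverPath V,
      mulLin K V (pathMul K p q) (ofPath K r) = mulLin K V (ofPath K p) (pathMul K q r) := by
    rintro ⟨a, b, p⟩ ⟨c, d, q⟩ ⟨e, f, r⟩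
    by_cases h₁ : d = a
    · subst h₁
      by_cases h₂ : f = c
      · subst h₂
        simp only [pathMul_of_eq, mulLin_ofPath, Quiver.Path.comp_assoc]
      · rw [pathMul_of_eq, mulLin_ofPath, pathMul_of_ne h₂, pathMul_of_ne h₂, map_zero]
    · by_cases h₂ : f = c
      · subst h₂
        rw [pathMul_of_eq, mulLin_ofPath, pathMul_of_ne h₁, pathMul_of_ne h₁, map_zero,
          LinearMap.zero_apply]
      · rw [pathMul_of_ne h₁, pathMul_of_ne h₂, map_zero, map_zero, LinearMap.zero_apply]
  have : (mulLin K V).compr₂ (mulLin K V) =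
      (LinearMap.llcomp K (PathAlgebra K V) (PathAlgebra K V) (PathAlgebra K V)).compl₁₂
        (mulLin K V) (mulLin K V) := by
    refine hom_ext fun p => hom_ext fun q => hom_ext fun r => ?_
    simpa [mulLin_ofPath] using key p q r
  simpa using congr($this x y z)

instance : Mul (PathAlgebra K V) := ⟨fun x y => mulLin K V x y⟩

theorem mul_def (x y : PathAlgebra K V) : x * y = mulLin K V x y := rfl

theorem ofPath_mul_ofPath (p q : QuiverPath V) : ofPath K p * ofPath K q = pathMul K p q :=
  mulLin_ofPath p q

/-- The identity is the sum of the trivial paths. -/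
instance [Fintype V] : One (PathAlgebra K V) :=
  ⟨∑ i : V, ofPath K ⟨i, i, Quiver.Path.nil⟩⟩

theorem one_def [Fintype V] :
    (1 : PathAlgebra K V) = ∑ i : V, ofPath K ⟨i, i, Quiver.Path.nil⟩ := rfl

theorem mulLin_one [Fintype V] (x : PathAlgebra K V) : mulLin K V x 1 = x := by
  have : (mulLin K V).flip 1 = LinearMap.id := by
    refine hom_ext fun p => ?_
    obtain ⟨a, b, p⟩ := p
    rw [LinearMap.flip_apply, one_def, map_sum, Finset.sum_eq_single a]
    · rw [mulLin_ofPath, pathMul_of_eq, Quiver.Path.nil_comp]; rfl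
    · intro i _ hi
      rw [mulLin_ofPath, pathMul_of_ne hi]
    · simp
  exact congr($this x)

theorem one_mulLin [Fintype V] (x : PathAlgebra K V) : mulLin K V 1 x = x := by
  have : mulLin K V 1 = LinearMap.id := by
    refine hom_ext fun p => ?_
    obtain ⟨a, b, p⟩ := p
    rw [one_def, map_sum, LinearMap.sum_apply, Finset.sum_eq_single b]
    · rw [mulLin_ofPath, pathMul_of_eq, Quiver.Path.comp_nil]; rfl
    · intro i _ hi
      rw [mulLin_ofPath, pathMul_of_ne (Ne.symm hi)]
    · simp
  exact congr($this x)

instance [Fintype V] : Ring (PathAlgebra K V) where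
  __ := (inferInstance : AddCommGroup (PathAlgebra K V))
  left_distrib x y z := map_add (mulLin K V x) y z
  right_distrib x y z := by simp only [mul_def, map_add, LinearMap.add_apply]
  zero_mul x := by simp only [mul_def, map_zero, LinearMap.zero_apply]
  mul_zero x := map_zero (mulLin K V x)
  mul_assoc := mulLin_assoc
  one_mul := one_mulLin
  mul_one := mulLin_one

instance [Fintype V] : Algebra K (PathAlgebra K V) :=
  Algebra.ofModule (fun r x y => by simp only [mul_def, map_smul, LinearMap.smul_apply])
    (fun r x y => by simp only [mul_def, map_smul])

end

section Action

variable {K : Type u} {V : Type v} [CommRing K] [Quiver.{w} V] {G : Type x} [Group G]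
  [QuiverAction G V]

/-- The linear map of the path algebra given by the action of `g` on paths. -/
def actLin (g : G) : PathAlgebra K V →ₗ[K] PathAlgebra K V :=
  Finsupp.lmapDomain K K (g • · : QuiverPath V → QuiverPath V)

theorem actLin_ofPath (g : G) (p : QuiverPath V) :
    actLin g (ofPath K p) = ofPath K (g • p) :=
  Finsupp.mapDomain_single

theorem smul_path (g : G) {a b : V} (p : Quiver.Path a b) :
    g • (⟨a, b, p⟩ : QuiverPath V) = ⟨_, _, (QuiverAction.act g : V ⥤q V).mapPath p⟩ := rfl

theorem obj_injective (g : G) :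
    Function.Injective (QuiverAction.act g : V ⥤q V).obj := by
  have h : ∀ x : V, (QuiverAction.act g⁻¹ : V ⥤q V).obj
      ((QuiverAction.act g : V ⥤q V).obj x) = x := by
    intro x
    have h1 : (QuiverAction.act g ⋙q QuiverAction.act g⁻¹ : V ⥤q V) = 𝟭q V := by
      rw [← QuiverAction.act_mul, inv_mul_cancel, QuiverAction.act_one]
    exact Prefunctor.congr_obj h1 x
  exact Function.LeftInverse.injective h

theorem actLin_pathMul (g : G) (p q : QuiverPath V) :
    actLin g (pathMul K p q) = pathMul K (g • p) (g • q) := by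
  obtain ⟨a, b, p⟩ := p
  obtain ⟨c, d, q⟩ := q
  by_cases h : d = a
  · subst h
    rw [pathMul_of_eq, actLin_ofPath, smul_path, smul_path, smul_path, pathMul_of_eq,
      Prefunctor.mapPath_comp]
  · rw [pathMul_of_ne h, map_zero, pathMul_of_ne]
    exact fun h' => h (obj_injective g h')

theorem actLin_mul (g : G) (x y : PathAlgebra K V) :
    actLin g (mulLin K V x y) = mulLin K V (actLin g x) (actLin g y) := by
  have : (mulLin K V).compr₂ (actLin g) = (mulLin K V).compl₁₂ (actLin g) (actLin g) := by
    refine hom_ext fun p => hom_ext fun q => ?_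
    simp [mulLin_ofPath, actLin_ofPath, actLin_pathMul]
  simpa using congr($this x y)

theorem obj_bijective (g : G) :
    Function.Bijective (QuiverAction.act g : V ⥤q V).obj := by
  refine ⟨obj_injective g, fun x => ⟨(QuiverAction.act g⁻¹ : V ⥤q V).obj x, ?_⟩⟩
  have h1 : (QuiverAction.act g⁻¹ ⋙q QuiverAction.act g : V ⥤q V) = 𝟭q V := by
    rw [← QuiverAction.act_mul, mul_inv_cancel, QuiverAction.act_one]
  exact Prefunctor.congr_obj h1 x

/-- The action of `G` on the path algebra by algebra automorphisms that is induced by an action on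
the quiver. -/
instance [Fintype V] : MulSemiringAction G (PathAlgebra K V) where
  smul g x := actLin g x
  one_smul x := by
    have : actLin (1 : G) = (LinearMap.id : PathAlgebra K V →ₗ[K] _) :=
      hom_ext fun p => by rw [actLin_ofPath, one_smul]; rfl
    exact congr($this x)
  mul_smul g h x := by
    have : actLin (g * h) = (actLin g).comp (actLin h : PathAlgebra K V →ₗ[K] _) :=
      hom_ext fun p => by
        rw [LinearMap.comp_apply, actLin_ofPath, actLin_ofPath, actLin_ofPath, mul_smul]
    exact congr($this x)
  smul_zero g := map_zero (actLin g)
  smul_add g := map_add (actLin g)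
  smul_one g := by
    change actLin g 1 = 1
    rw [one_def, map_sum]
    exact Fintype.sum_bijective _ (obj_bijective g) _ _ fun i => actLin_ofPath g _
  smul_mul g x y := actLin_mul g x y

theorem smul_ofPath [Fintype V] (g : G) (p : QuiverPath V) :
    g • ofPath K p = ofPath K (g • p) := actLin_ofPath g p

theorem smul_ofArrow [Fintype V] (g : G) (α : QuiverArrow V) :
    g • ofArrow K α = ofArrow K (g • α) := actLin_ofPath g _

instance [Fintype V] : SMulCommClass G K (PathAlgebra K V) :=
  ⟨fun g r x => map_smul (actLin g) r x⟩

end Action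

end PathAlgebra

/-! ### Preprojective algebras of quivers -/

section Preprojective

variable (K : Type u) (V : Type v) [CommRing K] [Quiver.{w} V] [Fintype V]
  [∀ a b : V, Fintype (a ⟶ b)]

/-- The element `∑ (α α^* - α^* α)` of the path algebra of the double quiver, where the sum is over
all arrows `α` of the given quiver. -/
def preprojectiveRelation : PathAlgebra K (Quiver.Symmetrify V) :=
  ∑ α : QuiverArrow V,
    (PathAlgebra.ofArrow K α.toDouble * PathAlgebra.ofArrow K α.star -
      PathAlgebra.ofArrow K α.star * PathAlgebra.ofArrow K α.toDouble)

/-- The preprojective algebra `Π(Q)`: the path algebra of the double quiver modulo the two-sided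
ideal generated by `∑ (α α^* - α^* α)`. -/
abbrev PreprojectiveAlgebra : Type (max u v w) :=
  (TwoSidedIdeal.span {preprojectiveRelation K V}).ringCon.Quotient

variable {K V} {G : Type x} [Group G] [QuiverAction G V]

theorem smul_preprojectiveRelation (g : G) :
    g • preprojectiveRelation K V = preprojectiveRelation K V := by
  rw [preprojectiveRelation, Finset.smul_sum]
  refine Fintype.sum_bijective (g • · : QuiverArrow V → QuiverArrow V)
    (MulAction.bijective g) _ _ fun α => ?_
  rw [smul_sub, smul_mul', smul_mul', PathAlgebra.smul_ofArrow, PathAlgebra.smul_ofArrow,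
    QuiverArrow.smul_toDouble, QuiverArrow.smul_star]

variable (K V) in
/-- The algebra endomorphism of the preprojective algebra induced by the action of `g` on the path
algebra of the double quiver. -/
def PreprojectiveAlgebra.actHom (g : G) : PreprojectiveAlgebra K V →+* PreprojectiveAlgebra K V :=
  RingCon.lift _
    ((RingCon.mk' _).comp (MulSemiringAction.toRingHom G (PathAlgebra K (Quiver.Symmetrify V)) g))
    (by
      have h : TwoSidedIdeal.span {preprojectiveRelation K V} ≤ TwoSidedIdeal.ker
          (((TwoSidedIdeal.span {preprojectiveRelation K V}).ringCon.mk').comp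
            (MulSemiringAction.toRingHom G (PathAlgebra K (Quiver.Symmetrify V)) g)) := by
        rw [TwoSidedIdeal.span_le, Set.singleton_subset_iff, SetLike.mem_coe,
          TwoSidedIdeal.mem_ker, RingHom.comp_apply, MulSemiringAction.toRingHom_apply,
          smul_preprojectiveRelation, ← TwoSidedIdeal.mem_ker, TwoSidedIdeal.ker_ringCon_mk']
        exact TwoSidedIdeal.subset_span rfl
      intro a b hab
      exact (TwoSidedIdeal.rel_iff _ a b).1 hab |> @h _ |> (TwoSidedIdeal.rel_iff _ a b).2)

theorem PreprojectiveAlgebra.actHom_mk (g : G) (a : PathAlgebra K (Quiver.Symmetrify V)) :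
    PreprojectiveAlgebra.actHom K V g (RingCon.mk' _ a) = RingCon.mk' _ (g • a) := rfl

/-- The action of `G` on the preprojective algebra, `g [a] = [g a]`. -/
instance PreprojectiveAlgebra.mulSemiringAction :
    MulSemiringAction G (PreprojectiveAlgebra K V) where
  smul g x := PreprojectiveAlgebra.actHom K V g x
  one_smul x := by
    obtain ⟨a, rfl⟩ := RingCon.mk'_surjective _ x
    exact congrArg (RingCon.mk' _) (one_smul G a)
  mul_smul g h x := by
    obtain ⟨a, rfl⟩ := RingCon.mk'_surjective _ x
    exact congrArg (RingCon.mk' _) (mul_smul g h a)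
  smul_zero g := map_zero (PreprojectiveAlgebra.actHom K V g)
  smul_add g := map_add (PreprojectiveAlgebra.actHom K V g)
  smul_one g := map_one (PreprojectiveAlgebra.actHom K V g)
  smul_mul g := map_mul (PreprojectiveAlgebra.actHom K V g)

theorem PreprojectiveAlgebra.smul_mk (g : G) (a : PathAlgebra K (Quiver.Symmetrify V)) :
    g • (RingCon.mk' _ a : PreprojectiveAlgebra K V) = RingCon.mk' _ (g • a) := rfl

instance PreprojectiveAlgebra.smulCommClass : SMulCommClass G K (PreprojectiveAlgebra K V) where
  smul_comm g r x := by
    obtain ⟨a, rfl⟩ := RingCon.mk'_surjective _ x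
    exact congrArg (RingCon.mk' _) (smul_comm g r a)

end Preprojective

/-! ### Tensor algebras of bimodules -/

section TensorAlgebra

variable (K : Type u) (A : Type v) (M : Type w) [CommRing K] [Ring A] [Algebra K A]
  [AddCommGroup M] [Module A M] [Module Aᵐᵒᵖ M]

/-- The relations of the tensor algebra `T_A(M)` between the generators `a ∈ A` and `m ∈ M`: the
generators from `A` multiply and add as in `A`, those from `M` add as in `M`, and the products of
`a` and `m` in both orders are `a m` and `m a`, computed in `M`. -/
inductive BimoduleTensorAlgebra.Rel : FreeAlgebra K (A ⊕ M) → FreeAlgebra K (A ⊕ M) → Prop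
  | algebraMap (r : K) :
      Rel (FreeAlgebra.ι K (Sum.inl (algebraMap K A r))) (algebraMap K _ r)
  | add_left (a b : A) : Rel (FreeAlgebra.ι K (Sum.inl (a + b)))
      (FreeAlgebra.ι K (Sum.inl a) + FreeAlgebra.ι K (Sum.inl b))
  | mul_left (a b : A) : Rel (FreeAlgebra.ι K (Sum.inl (a * b)))
      (FreeAlgebra.ι K (Sum.inl a) * FreeAlgebra.ι K (Sum.inl b))
  | add_right (m n : M) : Rel (FreeAlgebra.ι K (Sum.inr (m + n)))
      (FreeAlgebra.ι K (Sum.inr m) + FreeAlgebra.ι K (Sum.inr n))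
  | smul (a : A) (m : M) : Rel (FreeAlgebra.ι K (Sum.inr (a • m)))
      (FreeAlgebra.ι K (Sum.inl a) * FreeAlgebra.ι K (Sum.inr m))
  | op_smul (a : A) (m : M) : Rel (FreeAlgebra.ι K (Sum.inr (op a • m)))
      (FreeAlgebra.ι K (Sum.inr m) * FreeAlgebra.ι K (Sum.inl a))

/-- The tensor algebra `T_A(M) = A ⊕ M ⊕ (M ⊗_A M) ⊕ ⋯` of an `A`-`A`-bimodule `M` on which `K`
acts centrally (left multiplication by `a` is `a • m`, right multiplication is `op a • m`). Like
Mathlib's tensor algebra of a module over a commutative ring, it is built as a quotient of a free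
algebra; see `BimoduleTensorAlgebra.lift` and `BimoduleTensorAlgebra.hom_ext` for its universal
property. -/
@[nolint unusedArguments]
def BimoduleTensorAlgebra [SMulCommClass A Aᵐᵒᵖ M] [Module K M] [IsScalarTower K A M]
    [IsScalarTower K Aᵐᵒᵖ M] : Type (max u v w) :=
  RingQuot (BimoduleTensorAlgebra.Rel K A M)

end TensorAlgebra

namespace BimoduleTensorAlgebra

variable {K : Type u} {A : Type v} {M : Type w} [CommRing K] [Ring A] [Algebra K A]
  [AddCommGroup M] [Module K M] [Module A M] [Module Aᵐᵒᵖ M] [SMulCommClass A Aᵐᵒᵖ M]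
  [IsScalarTower K A M] [IsScalarTower K Aᵐᵒᵖ M]

instance : Ring (BimoduleTensorAlgebra K A M) :=
  inferInstanceAs (Ring (RingQuot (BimoduleTensorAlgebra.Rel K A M)))

instance : Algebra K (BimoduleTensorAlgebra K A M) :=
  inferInstanceAs (Algebra K (RingQuot (BimoduleTensorAlgebra.Rel K A M)))

variable (K A M) in
/-- The canonical map from `A` to the tensor algebra. -/
def ofRing : A →ₐ[K] BimoduleTensorAlgebra K A M where
  toFun a := RingQuot.mkAlgHom K (Rel K A M) (FreeAlgebra.ι K (Sum.inl a))
  map_one' := by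
    rw [← map_one (algebraMap K A), RingQuot.mkAlgHom_rel K (Rel.algebraMap 1), map_one, map_one]
    rfl
  map_zero' := by
    rw [← map_zero (algebraMap K A), RingQuot.mkAlgHom_rel K (Rel.algebraMap 0), map_zero, map_zero]
    rfl
  map_mul' a b := by rw [RingQuot.mkAlgHom_rel K (Rel.mul_left a b), map_mul]; rfl
  map_add' a b := by rw [RingQuot.mkAlgHom_rel K (Rel.add_left a b), map_add]; rfl
  commutes' r := by rw [RingQuot.mkAlgHom_rel K (Rel.algebraMap r), AlgHom.commutes]; rfl

variable (K A M) in
/-- The canonical map from `M` to the tensor algebra. -/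
def ofModule : M →+ BimoduleTensorAlgebra K A M :=
  AddMonoidHom.mk' (fun m => RingQuot.mkAlgHom K (Rel K A M) (FreeAlgebra.ι K (Sum.inr m)))
    fun m n => by rw [RingQuot.mkAlgHom_rel K (Rel.add_right m n), map_add]; rfl

theorem ofModule_smul (a : A) (m : M) :
    ofModule K A M (a • m) = ofRing K A M a * ofModule K A M m :=
  (RingQuot.mkAlgHom_rel K (Rel.smul a m)).trans (map_mul _ _ _)

theorem ofModule_op_smul (a : A) (m : M) :
    ofModule K A M (op a • m) = ofModule K A M m * ofRing K A M a :=
  (RingQuot.mkAlgHom_rel K (Rel.op_smul a m)).trans (map_mul _ _ _)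

/-- The universal property of the tensor algebra, existence: an algebra homomorphism `f : A → B`
and a map of `A`-`A`-bimodules `φ : M → B` extend to the tensor algebra. -/
def lift {B : Type*} [Ring B] [Algebra K B] (f : A →ₐ[K] B) (φ : M →+ B)
    (hl : ∀ (a : A) (m : M), φ (a • m) = f a * φ m)
    (hr : ∀ (a : A) (m : M), φ (op a • m) = φ m * f a) :
    BimoduleTensorAlgebra K A M →ₐ[K] B :=
  RingQuot.liftAlgHom K ⟨FreeAlgebra.lift K (Sum.elim f φ), fun _ _ h => by
    cases h <;> simp [hl, hr]⟩

theorem lift_ofRing {B : Type*} [Ring B] [Algebra K B] (f : A →ₐ[K] B) (φ : M →+ B)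
    (hl : ∀ (a : A) (m : M), φ (a • m) = f a * φ m)
    (hr : ∀ (a : A) (m : M), φ (op a • m) = φ m * f a) (a : A) :
    lift f φ hl hr (ofRing K A M a) = f a :=
  (RingQuot.liftAlgHom_mkAlgHom_apply K _ _ _).trans (by simp)

theorem lift_ofModule {B : Type*} [Ring B] [Algebra K B] (f : A →ₐ[K] B) (φ : M →+ B)
    (hl : ∀ (a : A) (m : M), φ (a • m) = f a * φ m)
    (hr : ∀ (a : A) (m : M), φ (op a • m) = φ m * f a) (m : M) :
    lift f φ hl hr (ofModule K A M m) = φ m :=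
  (RingQuot.liftAlgHom_mkAlgHom_apply K _ _ _).trans (by simp)

/-- The universal property of the tensor algebra, uniqueness. -/
theorem hom_ext {B : Type*} [Ring B] [Algebra K B] {F F' : BimoduleTensorAlgebra K A M →ₐ[K] B}
    (h₁ : ∀ a, F (ofRing K A M a) = F' (ofRing K A M a))
    (h₂ : ∀ m, F (ofModule K A M m) = F' (ofModule K A M m)) : F = F' := by
  refine RingQuot.ringQuot_ext' K _ _ (FreeAlgebra.hom_ext (funext fun z => ?_))
  rcases z with a | m
  · exact h₁ a
  · exact h₂ m

end BimoduleTensorAlgebra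

/-! ### Higher preprojective algebras -/

section HigherPreprojective

variable (K : Type u) (A : Type v) [CommRing K] [Ring A] [Algebra K A]

/-- The enveloping algebra `A^e = A ⊗ A^op`. -/
abbrev EnvelopingAlgebra : Type v := A ⊗[K] Aᵐᵒᵖ

/-- The algebra `A` as a left module over its enveloping algebra, `(a ⊗ b) x = a x b`. -/
def EnvelopingAlgebra.diagonal : ModuleCat.{v} (EnvelopingAlgebra K A) :=
  letI : Module (EnvelopingAlgebra K A) A := TensorProduct.Algebra.module
  ModuleCat.of (EnvelopingAlgebra K A) A

/-- The enveloping algebra as a left module over itself. -/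
def EnvelopingAlgebra.regular : ModuleCat.{v} (EnvelopingAlgebra K A) :=
  ModuleCat.of (EnvelopingAlgebra K A) (EnvelopingAlgebra K A)

variable {K A} in
/-- Right multiplication by `r`, an endomorphism of the left module `A^e`. -/
def EnvelopingAlgebra.mulRight (r : EnvelopingAlgebra K A) :
    EnvelopingAlgebra.regular K A ⟶ EnvelopingAlgebra.regular K A :=
  ModuleCat.ofHom (LinearMap.toSpanSingleton (EnvelopingAlgebra K A) (EnvelopingAlgebra K A) r)

/-- The space `Ext^n_{A^e}(A, A^e)`, computed in the category of left `A^e`-modules. -/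
def ExtBimodule (n : ℕ) : Type v :=
  Abelian.Ext.{v} (EnvelopingAlgebra.diagonal K A) (EnvelopingAlgebra.regular K A) n

namespace ExtBimodule

variable (n : ℕ)

instance : AddCommGroup (ExtBimodule K A n) :=
  inferInstanceAs (AddCommGroup (Abelian.Ext.{v} (EnvelopingAlgebra.diagonal K A)
    (EnvelopingAlgebra.regular K A) n))

/-- The right `A^e`-module structure of `Ext^n_{A^e}(A, A^e)`, induced by right multiplication on
`A^e`: the element `r` acts by composition with `A^e → A^e, s ↦ s r`. -/
instance : Module (EnvelopingAlgebra K A)ᵐᵒᵖ (ExtBimodule K A n) where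
  smul r e := Abelian.Ext.comp e (Abelian.Ext.mk₀ (EnvelopingAlgebra.mulRight r.unop)) (add_zero n)
  one_smul e := by
    have : EnvelopingAlgebra.mulRight (1 : EnvelopingAlgebra K A) = 𝟙 _ := by
      ext; exact mul_one (1 : EnvelopingAlgebra K A)
    exact (congrArg (fun f => Abelian.Ext.comp e (Abelian.Ext.mk₀ f) (add_zero n)) this).trans
      (Abelian.Ext.comp_mk₀_id _)
  mul_smul r s e := by
    have : EnvelopingAlgebra.mulRight (s.unop * r.unop) =
        EnvelopingAlgebra.mulRight s.unop ≫ EnvelopingAlgebra.mulRight r.unop := by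
      ext; exact (mul_assoc 1 s.unop r.unop).symm
    refine (congrArg (fun f => Abelian.Ext.comp e (Abelian.Ext.mk₀ f) (add_zero n)) this).trans ?_
    simp only [← Abelian.Ext.mk₀_comp_mk₀]
    exact (Abelian.Ext.comp_assoc _ _ _ (add_zero n) (add_zero 0) (by simp)).symm
  smul_zero r := Abelian.Ext.zero_comp ..
  smul_add r e f := Abelian.Ext.add_comp ..
  add_smul r s e := by
    have : EnvelopingAlgebra.mulRight (r.unop + s.unop) =
        EnvelopingAlgebra.mulRight r.unop + EnvelopingAlgebra.mulRight s.unop := by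
      ext; exact mul_add 1 r.unop s.unop
    refine (congrArg (fun f => Abelian.Ext.comp e (Abelian.Ext.mk₀ f) (add_zero n)) this).trans ?_
    simp only [Abelian.Ext.mk₀_add]
    exact Abelian.Ext.comp_add ..
  zero_smul e := by
    have : EnvelopingAlgebra.mulRight (0 : EnvelopingAlgebra K A) = 0 := by
      ext; exact mul_zero (1 : EnvelopingAlgebra K A)
    refine (congrArg (fun f => Abelian.Ext.comp e (Abelian.Ext.mk₀ f) (add_zero n)) this).trans ?_
    simp only [Abelian.Ext.mk₀_zero]
    exact Abelian.Ext.comp_zero ..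

/-- `a ↦ 1 ⊗ a`, as a ring homomorphism to the opposite of the enveloping algebra. -/
def leftHom : A →+* (EnvelopingAlgebra K A)ᵐᵒᵖ where
  toFun a := op ((1 : A) ⊗ₜ[K] op a)
  map_one' := rfl
  map_mul' a b := by simp [← op_mul]
  map_zero' := by simp
  map_add' a b := by simp [TensorProduct.tmul_add]

/-- `b ↦ b ⊗ 1`, as a ring homomorphism to the opposite of the enveloping algebra. -/
def rightHom : Aᵐᵒᵖ →+* (EnvelopingAlgebra K A)ᵐᵒᵖ where
  toFun b := op (b.unop ⊗ₜ[K] (1 : Aᵐᵒᵖ))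
  map_one' := rfl
  map_mul' a b := by simp [← op_mul]
  map_zero' := by simp
  map_add' a b := by simp [TensorProduct.add_tmul]

/-! A right `A^e`-module is an `A`-`A`-bimodule by `a e b = e (b ⊗ a)`; on `A^e` itself this is the
inner bimodule structure `a (x ⊗ y) b = x b ⊗ a y`. -/

instance : Module A (ExtBimodule K A n) := Module.compHom _ (leftHom K A)

instance : Module Aᵐᵒᵖ (ExtBimodule K A n) := Module.compHom _ (rightHom K A)

instance : Module K (ExtBimodule K A n) :=
  Module.compHom _ (algebraMap K (EnvelopingAlgebra K A)ᵐᵒᵖ)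

theorem smul_def (a : A) (e : ExtBimodule K A n) :
    a • e = op ((1 : A) ⊗ₜ[K] op a) • e := rfl

theorem op_smul_def (b : A) (e : ExtBimodule K A n) :
    op b • e = op (b ⊗ₜ[K] (1 : Aᵐᵒᵖ)) • e := rfl

instance : SMulCommClass A Aᵐᵒᵖ (ExtBimodule K A n) where
  smul_comm a b e := by
    change leftHom K A a • rightHom K A b • e = rightHom K A b • leftHom K A a • e
    rw [← mul_smul, ← mul_smul]
    congr 1
    simp [leftHom, rightHom, ← op_mul]

instance : IsScalarTower K A (ExtBimodule K A n) where
  smul_assoc r a e := by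
    change leftHom K A (r • a) • e = algebraMap K (EnvelopingAlgebra K A)ᵐᵒᵖ r • leftHom K A a • e
    rw [← mul_smul, ← Algebra.smul_def]
    exact congrArg (op · • e) (TensorProduct.tmul_smul r (1 : A) (op a))

instance : IsScalarTower K Aᵐᵒᵖ (ExtBimodule K A n) where
  smul_assoc r b e := by
    change rightHom K A (r • b) • e = algebraMap K (EnvelopingAlgebra K A)ᵐᵒᵖ r • rightHom K A b • e
    rw [← mul_smul, ← Algebra.smul_def]
    congr 1

end ExtBimodule

/-- The `n`-preprojective algebra `Π_n(A) = T_A(Ext^{n-1}_{A^e}(A, A^e))`, for `n ≥ 2`. -/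
abbrev HigherPreprojectiveAlgebra (n : ℕ) : Type (max u v) :=
  BimoduleTensorAlgebra K A (ExtBimodule K A (n - 1))

end HigherPreprojective

end

/-! Write B = KQ#G. The multiplication map gives an exact sequence 0 → Ω → B^e → B → 0 with
projective middle term, so Ext^1(B, B^e) is Hom(Ω, B^e) modulo the restrictions of endomorphisms of
B^e. As Ω is generated by the elements 1 ⊗ b - b ⊗ 1, this quotient consists of the double
derivations B → B ⊗ B modulo the inner ones (`doubleDerivation.toExt_surjective`,
`doubleDerivation.toExt_eq_zero_iff`), and the bimodule structure multiplies their values on the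
right.

Modulo inner derivations, a double derivation can be made to vanish on G and on the trivial paths
(`exists_normalized`). For G this is not done by averaging, which would need |G| to be invertible.
Instead, B is the direct sum of the pieces g KQ, so B ⊗ B is an induced G-module and its first
cohomology vanishes; `proj`, the coefficient of the neutral element in the first factor, makes the
contraction explicit. A normalized derivation is an equivariant family of values on arrows. The
derivation `dual α`, whose value at β is the sum of the g ⊗ g⁻¹ with g α = β, cut down by trivial
paths, plays the role of α^*. These derivations generate all normalized ones
(`sum_dual_mulRight_proj`), and the sum of their commutators with the arrows is inner
(`sum_dual_commutator`), which is the preprojective relation in Ext^1. Hence α^* ↦ [`dual α`]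
defines a homomorphism from Π(Q)#G to the tensor algebra.

In the other direction, `pairing` sends δ to the sum over α of b α^* a, where a ⊗ b runs through the
tensors in `proj` of δ(α). Inner derivations die by the preprojective relation (`pairing_inner`),
and the map is B-bilinear, so it extends to the tensor algebra. The two homomorphisms are inverse to
each other because `pairing` takes `dual α` back to α^* (`pairing_dual`) and because the `dual α`
generate (`toTensorAlgebra_pairing`). -/

noncomputable section

/-! ### First extension groups of cyclic modules -/

section CyclicModule

variable {R : Type v} [Ring R] {M : Type v} [AddCommGroup M] [Module R M] {π : R →ₗ[R] M}

/-- The connecting map to the first extension group of the quotient `M` of the regular module. -/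
def extOfKer (hπ : Function.Surjective π) : (LinearMap.ker π →ₗ[R] R) →+
    Abelian.Ext.{v} (ModuleCat.of R M) (ModuleCat.of R R) 1 :=
  AddMonoidHom.mk' (fun f => (LinearMap.shortExact_shortComplexKer hπ).extClass.comp
    (Abelian.Ext.mk₀ (ModuleCat.ofHom f)) (add_zero 1)) fun f g => by
    rw [ModuleCat.ofHom_add, Abelian.Ext.mk₀_add]
    exact Abelian.Ext.comp_add ..

theorem extOfKer_apply (hπ : Function.Surjective π) (f : LinearMap.ker π →ₗ[R] R) :
    extOfKer hπ f = (LinearMap.shortExact_shortComplexKer hπ).extClass.comp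
      (Abelian.Ext.mk₀ (ModuleCat.ofHom f)) (add_zero 1) := rfl

/-- The next term of the long exact sequence is the first extension group of the regular module,
which is projective. -/
theorem extOfKer_surjective (hπ : Function.Surjective π) :
    Function.Surjective (extOfKer hπ) := by
  intro e
  have : Projective π.shortComplexKer.X₂ :=
    inferInstanceAs (Projective (ModuleCat.of R R))
  obtain ⟨x, hx⟩ := Abelian.Ext.contravariant_sequence_exact₃
    (LinearMap.shortExact_shortComplexKer hπ) (ModuleCat.of R R)
    (n₁ := 1) e (Abelian.Ext.eq_zero_of_projective _) (add_zero 1)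
  obtain ⟨f, rfl⟩ := (Abelian.Ext.mk₀_bijective _ _).surjective x
  exact ⟨f.hom, hx⟩

/-- By exactness the connecting map kills the maps that extend to `R`, and an endomorphism of the
left regular module is right multiplication by its value at 1. -/
theorem extOfKer_eq_zero_iff (hπ : Function.Surjective π) (f : LinearMap.ker π →ₗ[R] R) :
    extOfKer hπ f = 0 ↔ ∃ r, ∀ s, f s = s.1 * r := by
  rw [extOfKer_apply]
  constructor
  · intro h
    obtain ⟨x, hx⟩ := Abelian.Ext.contravariant_sequence_exact₁
      (LinearMap.shortExact_shortComplexKer hπ) (ModuleCat.of R R) _ (add_zero 1) h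
    obtain ⟨g, rfl⟩ := (Abelian.Ext.mk₀_bijective _ _).surjective x
    rw [Abelian.Ext.mk₀_comp_mk₀] at hx
    have hg := (Abelian.Ext.mk₀_bijective _ _).injective hx
    refine ⟨g.hom (1 : R), fun s => ?_⟩
    refine (congrArg (fun φ => φ.hom s) hg).symm.trans ?_
    exact (congrArg g.hom (mul_one s.1).symm).trans (map_smul g.hom s.1 (1 : R))
  · rintro ⟨r, hr⟩
    have h : ModuleCat.ofHom f = π.shortComplexKer.f ≫
        ModuleCat.ofHom (LinearMap.toSpanSingleton R R r) := by
      ext s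
      exact hr s
    rw [h, ← Abelian.Ext.mk₀_comp_mk₀]
    exact ShortComplex.ShortExact.extClass_comp_assoc _ _

theorem extOfKer_comp (hπ : Function.Surjective π) (f : LinearMap.ker π →ₗ[R] R) (r : R) :
    extOfKer hπ ((LinearMap.toSpanSingleton R R r).comp f) =
      (extOfKer hπ f).comp (Abelian.Ext.mk₀ (ModuleCat.ofHom (LinearMap.toSpanSingleton R R r)))
        (add_zero 1) := by
  rw [extOfKer_apply, extOfKer_apply, ModuleCat.ofHom_comp, ← Abelian.Ext.mk₀_comp_mk₀]
  exact (Abelian.Ext.comp_assoc _ _ _ (add_zero 1) (add_zero 0) (by simp)).symm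

end CyclicModule

/-! ### The enveloping algebra with its outer multiplications -/

/-- The enveloping algebra, as a type of its own. -/
def Env (K : Type u) (B : Type v) [CommRing K] [Ring B] [Algebra K B] : Type v := B ⊗[K] Bᵐᵒᵖ

namespace Env

variable {K : Type u} {B : Type v} [CommRing K] [Ring B] [Algebra K B]

instance : Ring (Env K B) := inferInstanceAs (Ring (B ⊗[K] Bᵐᵒᵖ))

instance : Algebra K (Env K B) := inferInstanceAs (Algebra K (B ⊗[K] Bᵐᵒᵖ))

variable (K) in
/-- The element `b ⊗ 1`. -/
def left : B →ₐ[K] Env K B := (Algebra.TensorProduct.includeLeft : B →ₐ[K] B ⊗[K] Bᵐᵒᵖ)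

variable (K) in
/-- The element `1 ⊗ b`. -/
def right : B →ₗ[K] Env K B :=
  (Algebra.TensorProduct.includeRight : Bᵐᵒᵖ →ₐ[K] B ⊗[K] Bᵐᵒᵖ).toLinearMap.comp
    (opLinearEquiv K).toLinearMap

theorem right_one : right K (1 : B) = 1 := rfl

theorem right_mul (a b : B) : right K (a * b) = right K b * right K a :=
  map_mul (Algebra.TensorProduct.includeRight : Bᵐᵒᵖ →ₐ[K] B ⊗[K] Bᵐᵒᵖ) (op b) (op a)

theorem left_mul_right (a b : B) : left K a * right K b = (a ⊗ₜ[K] op b : B ⊗[K] Bᵐᵒᵖ) := by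
  refine (Algebra.TensorProduct.tmul_mul_tmul a 1 1 (op b)).trans ?_
  rw [mul_one, one_mul]

theorem right_mul_left (a b : B) : right K b * left K a = left K a * right K b := by
  rw [left_mul_right]
  refine (Algebra.TensorProduct.tmul_mul_tmul 1 a (op b) 1).trans ?_
  rw [mul_one, one_mul]

theorem right_mul_left_mul (a b : B) (r : Env K B) :
    right K b * (left K a * r) = left K a * (right K b * r) := by
  rw [← mul_assoc, right_mul_left, mul_assoc]

@[elab_as_elim]
theorem induction {P : Env K B → Prop} (r : Env K B) (h : ∀ a b, P (left K a * right K b))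
    (hadd : ∀ r s, P r → P s → P (r + s)) : P r := by
  refine TensorProduct.induction_on (motive := P) r ?_ (fun a b => ?_) hadd
  · have := h 0 0
    rwa [map_zero, zero_mul] at this
  · have := h a b.unop
    rwa [left_mul_right] at this

/-- The linear map on the enveloping algebra given by a bilinear map. -/
def lift {M : Type*} [AddCommGroup M] [Module K M] (f : B →ₗ[K] B →ₗ[K] M) : Env K B →ₗ[K] M :=
  TensorProduct.lift (f.compl₂ (opLinearEquiv K).symm.toLinearMap)

theorem lift_apply {M : Type*} [AddCommGroup M] [Module K M] (f : B →ₗ[K] B →ₗ[K] M) (a b : B) :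
    lift f (left K a * right K b) = f a b := by
  rw [left_mul_right]
  rfl

theorem hom_ext {M : Type*} [AddCommGroup M] [Module K M] {f g : Env K B →ₗ[K] M}
    (h : ∀ a b, f (left K a * right K b) = g (left K a * right K b)) : f = g :=
  LinearMap.ext fun r => induction r h fun r s hr hs => by rw [map_add, map_add, hr, hs]

/-- The action of the enveloping algebra on the algebra. -/
instance : Module (Env K B) B :=
  (TensorProduct.Algebra.module : Module (B ⊗[K] Bᵐᵒᵖ) B)

theorem left_mul_right_smul (a b c : B) : (left K a * right K b) • c = a * c * b := by
  let := TensorProduct.Algebra.module (R := K) (A := B) (B := Bᵐᵒᵖ) (M := B)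
  rw [left_mul_right]
  exact (TensorProduct.Algebra.smul_def a (op b) c).trans (mul_assoc _ _ _).symm

variable (K B) in
/-- The multiplication map from the enveloping algebra to the algebra. -/
def mulMap : Env K B →ₗ[Env K B] B := LinearMap.toSpanSingleton (Env K B) B 1

theorem mulMap_left_mul_right (a b : B) : mulMap K B (left K a * right K b) = a * b :=
  (left_mul_right_smul a b 1).trans (by rw [mul_one])

theorem mulMap_surjective : Function.Surjective (mulMap K B) := fun b =>
  ⟨left K b * right K 1, (mulMap_left_mul_right b 1).trans (mul_one b)⟩

end Env

/-! ### Double derivations -/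

section DoubleDerivation

open Env

variable (K : Type u) (B : Type v) [CommRing K] [Ring B] [Algebra K B]

/-- The double derivations of `B`, that is, the derivations from `B` to `B ⊗ B` with its outer
bimodule structure. -/
def doubleDerivation : Submodule K (B →ₗ[K] Env K B) where
  carrier := {δ | ∀ a b, δ (a * b) = left K a * δ b + right K b * δ a}
  zero_mem' a b := by simp
  add_mem' {δ ε} hδ hε a b := by
    simp only [LinearMap.add_apply, hδ a b, hε a b, mul_add]
    abel
  smul_mem' c δ hδ a b := by
    simp only [LinearMap.smul_apply, hδ a b, smul_add, mul_smul_comm]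

variable {K B}

namespace doubleDerivation

theorem map_mul (δ : doubleDerivation K B) (a b : B) :
    δ.1 (a * b) = left K a * δ.1 b + right K b * δ.1 a := δ.2 a b

theorem map_one (δ : doubleDerivation K B) : δ.1 1 = 0 := by
  have h := map_mul δ 1 1
  rw [mul_one, right_one, _root_.map_one (left K), one_mul] at h
  simpa using h

@[ext]
theorem ext {δ ε : doubleDerivation K B} (h : ∀ b, δ.1 b = ε.1 b) : δ = ε :=
  Subtype.ext (LinearMap.ext h)

/-- Right multiplication of a double derivation by an element of the enveloping algebra. -/
def mulRight (δ : doubleDerivation K B) (r : Env K B) : doubleDerivation K B :=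
  ⟨(LinearMap.mulRight K r).comp δ.1, fun a b => by
    simp [map_mul, add_mul, mul_assoc]⟩

theorem mulRight_apply (δ : doubleDerivation K B) (r : Env K B) (b : B) :
    (mulRight δ r).1 b = δ.1 b * r := rfl

variable (K B) in
/-- The inner double derivation `b ↦ (b ⊗ 1 - 1 ⊗ b) r`. -/
def inner (r : Env K B) : doubleDerivation K B :=
  ⟨(LinearMap.mulRight K r).comp ((left K).toLinearMap - right K), fun a b => by
    simp only [LinearMap.comp_apply, LinearMap.mulRight_apply, LinearMap.sub_apply,
      AlgHom.toLinearMap_apply, right_mul, _root_.map_mul, sub_mul, mul_sub, mul_assoc,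
      right_mul_left_mul]
    abel⟩

theorem inner_apply (r : Env K B) (b : B) :
    (inner K B r).1 b = left K b * r - right K b * r :=
  sub_mul _ _ _

/-- The linear map `a ⊗ b ↦ a δ(b)`. -/
def contract (δ : doubleDerivation K B) : Env K B →ₗ[K] Env K B :=
  lift ((LinearMap.mul K (Env K B)).compl₁₂ (left K).toLinearMap δ.1)

theorem contract_apply (δ : doubleDerivation K B) (a b : B) :
    contract δ (left K a * right K b) = left K a * δ.1 b :=
  lift_apply _ _ _

/-- The Leibniz rule leaves a defect that contains the product `mulMap K B r`. It disappears on the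
kernel of the multiplication, where contraction thus becomes linear over the enveloping algebra. -/
theorem contract_mul (δ : doubleDerivation K B) (a b : B) (r : Env K B) :
    contract δ (left K a * right K b * r) = left K a * right K b * contract δ r +
      left K (a * mulMap K B r) * δ.1 b := by
  induction r using Env.induction with
  | h c d =>
    rw [mulMap_left_mul_right, mul_assoc, right_mul_left_mul, ← right_mul, ← mul_assoc,
      ← _root_.map_mul, contract_apply, contract_apply, map_mul, mul_add]
    simp only [_root_.map_mul, mul_assoc, right_mul_left_mul]
    rw [add_comm]
  | hadd r s hr hs =>
    rw [mul_add, map_add, map_add, hr, hs, map_add, mul_add, mul_add, map_add, add_mul]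
    abel

theorem contract_mul_of_mem_ker (δ : doubleDerivation K B) (s r : Env K B)
    (hr : mulMap K B r = 0) : contract δ (s * r) = s * contract δ r := by
  induction s using Env.induction with
  | h a b => rw [contract_mul, hr, mul_zero, map_zero, zero_mul, add_zero]
  | hadd s t hs ht => rw [add_mul, map_add, hs, ht, add_mul]

variable (K B) in
/-- The linear map on the kernel of the multiplication given by a double derivation. -/
def toHom : doubleDerivation K B →+ (LinearMap.ker (mulMap K B) →ₗ[Env K B] Env K B) :=
  AddMonoidHom.mk' (fun δ =>
    { toFun := fun r => contract δ r.1
      map_add' := fun r s => map_add (contract δ) r.1 s.1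
      map_smul' := fun s r => contract_mul_of_mem_ker δ s r.1 r.2 }) fun δ ε => by
    ext r
    change contract (δ + ε) r.1 = contract δ r.1 + contract ε r.1
    induction r.1 using Env.induction with
    | h a b => simp only [contract_apply, Submodule.coe_add, LinearMap.add_apply, mul_add]
    | hadd r s hr hs => rw [map_add, map_add, map_add, hr, hs]; abel

theorem toHom_apply (δ : doubleDerivation K B) (r : LinearMap.ker (mulMap K B)) :
    toHom K B δ r = contract δ r.1 := rfl

/-- The universal double derivation `b ↦ 1 ⊗ b - b ⊗ 1`. -/
def universal : B →ₗ[K] Env K B := right K - (left K).toLinearMap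

theorem universal_apply (b : B) : (universal b : Env K B) = right K b - left K b := rfl

theorem universal_mem (b : B) : (universal b : Env K B) ∈ LinearMap.ker (mulMap K B) := by
  have h1 := mulMap_left_mul_right (K := K) 1 b
  have h2 := mulMap_left_mul_right (K := K) b 1
  rw [_root_.map_one, one_mul] at h1
  rw [right_one, mul_one] at h2
  rw [LinearMap.mem_ker, universal_apply, map_sub, h1, h2]
  simp

theorem universal_mul (a b : B) :
    (universal (a * b) : Env K B) = left K a * universal b + right K b * universal a := by
  simp only [universal_apply, mul_sub, right_mul, _root_.map_mul, right_mul_left]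
  abel

/-- Only 1 ⊗ b contributes, since δ(1) = 0. Thus every double derivation factors through the
universal one. -/
theorem contract_universal (δ : doubleDerivation K B) (b : B) :
    contract δ (universal b) = δ.1 b := by
  have h1 := contract_apply δ 1 b
  have h2 := contract_apply δ b 1
  rw [_root_.map_one, one_mul, one_mul] at h1
  rw [right_one, mul_one, map_one, mul_zero] at h2
  rw [universal_apply, map_sub, h1, h2, sub_zero]

/-- The double derivation given by a linear map on the kernel of the multiplication. -/
def ofHom (f : LinearMap.ker (mulMap K B) →ₗ[Env K B] Env K B) : doubleDerivation K B :=
  ⟨(f.restrictScalars K).comp (universal.codRestrict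
    ((LinearMap.ker (mulMap K B)).restrictScalars K) universal_mem), fun a b => by
    have h : (⟨universal (a * b), universal_mem (a * b)⟩ : LinearMap.ker (mulMap K B)) =
        left K a • ⟨universal b, universal_mem b⟩ +
          right K b • ⟨universal a, universal_mem a⟩ :=
      Subtype.ext (universal_mul a b)
    refine (congrArg f h).trans ((map_add f _ _).trans ?_)
    exact congrArg₂ (· + ·) (map_smul f _ _) (map_smul f _ _)⟩

theorem ofHom_apply (f : LinearMap.ker (mulMap K B) →ₗ[Env K B] Env K B) (b : B) :
    (ofHom f).1 b = f ⟨universal b, universal_mem b⟩ := rfl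

/-- This holds because a ⊗ b - ab ⊗ 1 is a times the universal derivation of b, so that the kernel
is generated by universal derivatives. -/
theorem toHom_ofHom (f : LinearMap.ker (mulMap K B) →ₗ[Env K B] Env K B) :
    toHom K B (ofHom f) = f := by
  -- Elements of the kernel need not be sums of pure tensors lying in it. The claim is therefore
  -- stated for every `r`, corrected by its product, to allow induction on tensors.
  have key : ∀ r : Env K B, ∃ h : r - left K (mulMap K B r) ∈ LinearMap.ker (mulMap K B),
      contract (ofHom f) r = f ⟨_, h⟩ := by
    intro r
    induction r using Env.induction with
    | h a b =>
      have h : left K a * right K b - left K (mulMap K B (left K a * right K b)) =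
          left K a * universal b := by
        rw [universal_apply, mul_sub, mulMap_left_mul_right, _root_.map_mul]
      refine ⟨h ▸ Submodule.smul_mem _ _ (universal_mem b), ?_⟩
      rw [contract_apply, ofHom_apply]
      exact (map_smul f _ _).symm.trans (congrArg f (Subtype.ext h.symm))
    | hadd r s hr hs =>
      obtain ⟨hr, hr'⟩ := hr
      obtain ⟨hs, hs'⟩ := hs
      have h : r + s - left K (mulMap K B (r + s)) =
          (r - left K (mulMap K B r)) + (s - left K (mulMap K B s)) := by
        rw [map_add, map_add]
        abel
      refine ⟨h ▸ Submodule.add_mem _ hr hs, ?_⟩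
      rw [map_add, hr', hs']
      exact (map_add f _ _).symm.trans (congrArg f (Subtype.ext h.symm))
  ext r
  obtain ⟨h, h'⟩ := key r.1
  refine h'.trans (congrArg f (Subtype.ext ?_))
  have hr : mulMap K B r.1 = 0 := r.2
  simp [hr]

/-- The sign appears because the universal derivation is 1 ⊗ b - b ⊗ 1, while inner derivations use
b ⊗ 1 - 1 ⊗ b. -/
theorem toHom_eq_iff (δ : doubleDerivation K B) (r : Env K B) :
    (∀ s, toHom K B δ s = s.1 * r) ↔ δ = inner K B (-r) := by
  constructor
  · intro h
    ext b
    rw [← contract_universal]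
    refine (h ⟨universal b, universal_mem b⟩).trans ?_
    rw [inner_apply, mul_neg, mul_neg]
    change (right K b - left K b) * r = _
    rw [sub_mul]
    abel
  · rintro rfl ⟨s, hs⟩
    have key : ∀ s : Env K B, contract (inner K B (-r)) s =
        s * r - left K (mulMap K B s) * r := by
      intro s
      induction s using Env.induction with
      | h a b =>
        rw [contract_apply, inner_apply, mulMap_left_mul_right, mul_sub, _root_.map_mul]
        simp [mul_assoc]
        abel
      | hadd s t hs ht =>
        rw [map_add, map_add, hs, ht, map_add, add_mul, add_mul]
        abel
    have hs' : mulMap K B s = 0 := hs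
    rw [toHom_apply, key, hs']
    simp

variable (K B) in
/-- The connecting map to the extension bimodule. -/
def connecting : (LinearMap.ker (mulMap K B) →ₗ[Env K B] Env K B) →+ ExtBimodule K B 1 :=
  extOfKer (R := EnvelopingAlgebra K B) (M := EnvelopingAlgebra.diagonal K B) (π := mulMap K B)
    (mulMap_surjective (K := K) (B := B))

theorem connecting_surjective : Function.Surjective (connecting K B) :=
  extOfKer_surjective (R := EnvelopingAlgebra K B) (M := EnvelopingAlgebra.diagonal K B)
    (π := mulMap K B) (mulMap_surjective (K := K) (B := B))

theorem connecting_eq_zero_iff (f : LinearMap.ker (mulMap K B) →ₗ[Env K B] Env K B) :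
    connecting K B f = 0 ↔ ∃ r, ∀ s, f s = s.1 * r :=
  extOfKer_eq_zero_iff (R := EnvelopingAlgebra K B) (M := EnvelopingAlgebra.diagonal K B)
    (π := mulMap K B) (mulMap_surjective (K := K) (B := B)) f

theorem connecting_comp (f : LinearMap.ker (mulMap K B) →ₗ[Env K B] Env K B) (r : Env K B) :
    connecting K B ((LinearMap.toSpanSingleton (Env K B) (Env K B) r).comp f) =
      (op r : (EnvelopingAlgebra K B)ᵐᵒᵖ) • connecting K B f :=
  extOfKer_comp (R := EnvelopingAlgebra K B) (M := EnvelopingAlgebra.diagonal K B)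
    (π := mulMap K B) (mulMap_surjective (K := K) (B := B)) f r

variable (K B) in
/-- The class of a double derivation. -/
def toExt : doubleDerivation K B →+ ExtBimodule K B 1 := (connecting K B).comp (toHom K B)

theorem toExt_surjective : Function.Surjective (toExt K B) := by
  intro e
  obtain ⟨f, hf⟩ := connecting_surjective e
  exact ⟨ofHom f, (congrArg (connecting K B) (toHom_ofHom f)).trans hf⟩

theorem toExt_eq_zero_iff (δ : doubleDerivation K B) :
    toExt K B δ = 0 ↔ ∃ r, δ = inner K B r :=
  (connecting_eq_zero_iff (toHom K B δ)).trans
    ⟨fun ⟨r, hr⟩ => ⟨-r, (toHom_eq_iff δ r).1 hr⟩,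
      fun ⟨r, hr⟩ => ⟨-r, (toHom_eq_iff δ (-r)).2 (by rw [neg_neg, hr])⟩⟩

theorem toExt_mulRight (δ : doubleDerivation K B) (r : Env K B) :
    toExt K B (mulRight δ r) = (op r : (EnvelopingAlgebra K B)ᵐᵒᵖ) • toExt K B δ := by
  have h : toHom K B (mulRight δ r) =
      (LinearMap.toSpanSingleton (Env K B) (Env K B) r).comp (toHom K B δ) := by
    ext s
    change contract (mulRight δ r) s.1 = contract δ s.1 * r
    induction s.1 using Env.induction with
    | h a b => simp only [contract_apply, mulRight_apply, mul_assoc]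
    | hadd s t hs ht => rw [map_add, map_add, hs, ht, add_mul]
  exact (congrArg (connecting K B) h).trans (connecting_comp _ r)

theorem toExt_mulRight_left (δ : doubleDerivation K B) (b : B) :
    toExt K B (mulRight δ (left K b)) = op b • toExt K B δ :=
  toExt_mulRight δ (left K b)

theorem toExt_mulRight_right (δ : doubleDerivation K B) (b : B) :
    toExt K B (mulRight δ (right K b)) = b • toExt K B δ :=
  toExt_mulRight δ (right K b)

end doubleDerivation

end DoubleDerivation

/-! ### Generators of path algebras -/

namespace PathAlgebra

variable {K : Type u} {V : Type v} [CommRing K] [Quiver.{w} V]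

variable (K) in
/-- The trivial path at a vertex. -/
def vertex (i : V) : PathAlgebra K V := ofPath K ⟨i, i, Quiver.Path.nil⟩

theorem vertex_mul_self (i : V) : vertex K i * vertex K i = vertex K i :=
  (ofPath_mul_ofPath _ _).trans (pathMul_of_eq _ _)

theorem vertex_mul_of_ne {i j : V} (h : i ≠ j) : vertex K i * vertex K j = 0 :=
  (ofPath_mul_ofPath _ _).trans (pathMul_of_ne h.symm)

theorem ofArrow_mul_vertex (α : QuiverArrow V) : ofArrow K α * vertex K α.src = ofArrow K α :=
  (ofPath_mul_ofPath _ _).trans (pathMul_of_eq _ _)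

theorem vertex_mul_ofArrow (α : QuiverArrow V) : vertex K α.tgt * ofArrow K α = ofArrow K α :=
  (ofPath_mul_ofPath _ _).trans (pathMul_of_eq _ _)

/-- Products run from right to left, so the last arrow of a path is its leftmost factor. -/
theorem ofPath_cons {a b c : V} (p : Quiver.Path a b) (α : b ⟶ c) :
    ofPath K ⟨a, c, p.cons α⟩ = ofArrow K ⟨b, c, α⟩ * ofPath K ⟨a, b, p⟩ :=
  ((ofPath_mul_ofPath _ _).trans (pathMul_of_eq (Quiver.Hom.toPath α) p)).symm

section Lift

variable {C : Type*} [Ring C] [Algebra K C] (e : V → C) (a : QuiverArrow V → C)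

/-- The product of the values of the arrows of a path. -/
def pathVal {i : V} : ∀ {j : V}, Quiver.Path i j → C
  | _, .nil => e i
  | _, .cons (b := j) (c := k) p α => a ⟨j, k, α⟩ * pathVal p

variable {e a}

theorem pathVal_mul (he : ∀ i, e i * e i = e i) {i j : V}
    (p : Quiver.Path i j) : pathVal e a p * e i = pathVal e a p := by
  induction p with
  | nil => exact he i
  | cons p α ih => rw [pathVal, mul_assoc, ih]

theorem mul_pathVal (he : ∀ i, e i * e i = e i) (hat : ∀ α, e α.tgt * a α = a α) {i j : V}
    (p : Quiver.Path i j) : e j * pathVal e a p = pathVal e a p := by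
  cases p with
  | nil => exact he i
  | cons p α => rw [pathVal, ← mul_assoc, hat ⟨_, _, α⟩]

theorem pathVal_comp (he : ∀ i, e i * e i = e i) (hat : ∀ α, e α.tgt * a α = a α) {i j k : V}
    (p : Quiver.Path i j) (q : Quiver.Path j k) :
    pathVal e a (p.comp q) = pathVal e a q * pathVal e a p := by
  induction q with
  | nil => exact (mul_pathVal he hat p).symm
  | cons q α ih => rw [Quiver.Path.comp_cons, pathVal, pathVal, ih, mul_assoc]

variable (K e a) in
/-- The linear extension of `pathVal`. -/
def liftLin : PathAlgebra K V →ₗ[K] C :=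
  Finsupp.lift C K (QuiverPath V) fun p => pathVal e a p.path

theorem liftLin_ofPath (p : QuiverPath V) : liftLin K e a (ofPath K p) = pathVal e a p.path := by
  refine (Finsupp.lift_apply _ _ _ _ _).trans ?_
  exact (Finsupp.sum_single_index (a := p) (b := (1 : K)) (zero_smul K _)).trans (one_smul K _)

variable [Fintype V]

variable (K) in
/-- The algebra homomorphism from the path algebra given by orthogonal idempotents and the images
of the arrows. -/
def lift (he : ∀ i, e i * e i = e i) (hne : ∀ i j, i ≠ j → e i * e j = 0) (h1 : ∑ i, e i = 1)
    (hat : ∀ α, e α.tgt * a α = a α) : PathAlgebra K V →ₐ[K] C :=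
  AlgHom.ofLinearMap (liftLin K e a)
    (by
      rw [one_def, map_sum, ← h1]
      exact Finset.sum_congr rfl fun i _ => liftLin_ofPath _)
    (by
      intro x y
      have : (mulLin K V).compr₂ (liftLin K e a) =
          (LinearMap.mul K C).compl₁₂ (liftLin K e a) (liftLin K e a) := by
        refine hom_ext fun p => hom_ext fun q => ?_
        simp only [LinearMap.compr₂_apply, LinearMap.compl₁₂_apply, LinearMap.mul_apply',
          mulLin_ofPath, liftLin_ofPath]
        obtain ⟨i, j, p⟩ := p
        obtain ⟨k, l, q⟩ := q
        by_cases h : l = i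
        · subst h
          rw [pathMul_of_eq, liftLin_ofPath, pathVal_comp he hat]
        -- Each value absorbs the idempotents of its end points; when the paths do not meet, two
        -- orthogonal idempotents stand side by side.
        · rw [pathMul_of_ne h, map_zero, ← pathVal_mul he p, ← mul_pathVal he hat q,
            mul_assoc, ← mul_assoc (e i), hne i l (Ne.symm h), zero_mul, mul_zero]
      exact congr($this x y))

variable (he : ∀ i, e i * e i = e i) (hne : ∀ i j, i ≠ j → e i * e j = 0) (h1 : ∑ i, e i = 1)
    (hat : ∀ α, e α.tgt * a α = a α)

theorem lift_vertex (i : V) : lift K he hne h1 hat (vertex K i) = e i :=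
  liftLin_ofPath _

/-- A path of length one evaluates to `a α * e α.src`, which is why the condition at the source
enters. -/
theorem lift_ofArrow {α : QuiverArrow V} (has : a α * e α.src = a α) :
    lift K he hne h1 hat (ofArrow K α) = a α :=
  (liftLin_ofPath _).trans has

end Lift

variable [Fintype V]

theorem sum_vertex : ∑ i : V, vertex K i = 1 := rfl

/-- Basis of all later checks on generators: equalizers of homomorphisms and intertwining conditions
are subalgebras. -/
theorem subalgebra_eq_top {S : Subalgebra K (PathAlgebra K V)} (hv : ∀ i, vertex K i ∈ S)
    (ha : ∀ α, ofArrow K α ∈ S) : S = ⊤ := by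
  have hp : ∀ {a b : V} (p : Quiver.Path a b), ofPath K ⟨a, b, p⟩ ∈ S := by
    intro a b p
    induction p with
    | nil => exact hv a
    | cons p α ih => rw [ofPath_cons]; exact S.mul_mem (ha _) ih
  refine eq_top_iff.2 fun x _ => ?_
  refine Finsupp.induction_linear (motive := fun x : QuiverPath V →₀ K =>
    (show PathAlgebra K V from x) ∈ S) x S.zero_mem (fun f g hf hg => S.add_mem hf hg) ?_
  intro p c
  have h : (Finsupp.single p c : QuiverPath V →₀ K) = (c • ofPath K p : PathAlgebra K V) :=
    (Finsupp.smul_single_one p c).symm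
  rw [h]
  exact S.smul_mem (hp p.path) c

theorem algHom_ext {C : Type*} [Ring C] [Algebra K C] {f g : PathAlgebra K V →ₐ[K] C}
    (hv : ∀ i, f (vertex K i) = g (vertex K i))
    (ha : ∀ α, f (ofArrow K α) = g (ofArrow K α)) : f = g := by
  have h : AlgHom.equalizer f g = ⊤ := subalgebra_eq_top hv ha
  ext x
  have hx : x ∈ AlgHom.equalizer f g := h ▸ Algebra.mem_top
  exact hx

section Action

variable {G : Type x} [Group G] [QuiverAction G V]

theorem smul_vertex (g : G) (i : V) :
    g • vertex K i = vertex K ((QuiverAction.act g : V ⥤q V).obj i) := smul_ofPath g _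

end Action

end PathAlgebra

/-! ### Skew group algebras -/

namespace SkewMonoidAlgebra

variable {K : Type*} {A : Type*} {G : Type*} [CommRing K] [Ring A] [Algebra K A] [Group G]
  [MulSemiringAction G A] [SMulCommClass G K A]

variable (K A G) in
/-- The inclusion of the coefficients. -/
def incl : A →ₐ[K] SkewMonoidAlgebra A G where
  __ := (singleOneRingHom : A →+* SkewMonoidAlgebra A G)
  commutes' _ := rfl

theorem incl_apply (a : A) : incl K A G a = single 1 a := rfl

variable (A) in
/-- The inclusion of the group. -/
def grp : G →* SkewMonoidAlgebra A G := of A G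

theorem grp_apply (g : G) : grp A g = single g 1 := rfl

theorem grp_mul_inv (g : G) : grp A g * grp A g⁻¹ = 1 := by
  rw [← map_mul, mul_inv_cancel, map_one]

theorem grp_inv_mul (g : G) : grp A g⁻¹ * grp A g = 1 := by
  rw [← map_mul, inv_mul_cancel, map_one]

theorem grp_mul_incl (g : G) (a : A) :
    grp A g * incl K A G a = incl K A G (g • a) * grp A g := by
  rw [incl_apply, incl_apply, grp_apply, single_mul_single, single_mul_single]
  simp

theorem incl_mul_grp (g : G) (a : A) : incl K A G a * grp A g = single g a := by
  rw [incl_apply, grp_apply, single_mul_single]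
  simp

theorem subalgebra_eq_top {S : Subalgebra K (SkewMonoidAlgebra A G)}
    (hi : ∀ a, incl K A G a ∈ S) (hg : ∀ g, grp A g ∈ S) : S = ⊤ := by
  refine eq_top_iff.2 fun x _ => ?_
  induction x using SkewMonoidAlgebra.induction_on with
  | zero => exact S.zero_mem
  | single g a => rw [← incl_mul_grp (K := K)]; exact S.mul_mem (hi a) (hg g)
  | add x y hx hy => exact S.add_mem (hx trivial) (hy trivial)

theorem algHom_ext_incl {C : Type*} [Ring C] [Algebra K C]
    {f f' : SkewMonoidAlgebra A G →ₐ[K] C} (hi : ∀ a, f (incl K A G a) = f' (incl K A G a))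
    (hg : ∀ g, f (grp A g) = f' (grp A g)) : f = f' := by
  have h : AlgHom.equalizer f f' = ⊤ := subalgebra_eq_top hi hg
  ext x
  have hx : x ∈ AlgHom.equalizer f f' := h ▸ Algebra.mem_top
  exact hx

section Lift

variable {C : Type*} [Ring C] [Algebra K C] (f : A →ₐ[K] C) (u : G →* C)
  (h : ∀ {a : A} {g : G}, f (g • a) * u g = u g * f a)

theorem liftNCAlgHom_incl (a : A) : liftNCAlgHom f u h (incl K A G a) = f a := by
  refine (liftNC_single (f : A →+ C) u 1 a).trans ?_
  simp

theorem liftNCAlgHom_grp (g : G) : liftNCAlgHom f u h (grp A g) = u g := by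
  refine (liftNC_single (f : A →+ C) u g 1).trans ?_
  simp

end Lift

variable (K A G) in
/-- The coefficient of the neutral element, as an element of the skew group algebra. -/
def coeffOne : SkewMonoidAlgebra A G →ₗ[K] SkewMonoidAlgebra A G where
  toFun x := incl K A G (x.coeff 1)
  map_add' x y := by rw [coeff_add, Finsupp.add_apply, map_add]
  map_smul' c x := by rw [coeff_smul, Finsupp.smul_apply, map_smul, RingHom.id_apply]

theorem coeffOne_apply (x : SkewMonoidAlgebra A G) :
    coeffOne K A G x = incl K A G (x.coeff 1) := rfl

theorem coeffOne_one : coeffOne K A G 1 = 1 := by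
  rw [coeffOne_apply, one_def, coeff_single, Finsupp.single_eq_same, map_one, one_def]

theorem coeffOne_grp_of_ne {g : G} (hg : g ≠ 1) (a : A) :
    coeffOne K A G (grp A g * incl K A G a) = 0 := by
  rw [grp_mul_incl, incl_mul_grp, coeffOne_apply, coeff_single, Finsupp.single_eq_of_ne hg.symm,
    map_zero]

theorem coeffOne_incl_mul (a : A) (x : SkewMonoidAlgebra A G) :
    coeffOne K A G (incl K A G a * x) = incl K A G a * coeffOne K A G x := by
  rw [coeffOne_apply, coeffOne_apply, ← map_mul]
  exact congrArg _ (coeff_single_one_mul x a 1)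

theorem coeffOne_mul_incl (a : A) (x : SkewMonoidAlgebra A G) :
    coeffOne K A G (x * incl K A G a) = coeffOne K A G x * incl K A G a := by
  rw [coeffOne_apply, coeffOne_apply, ← map_mul]
  exact congrArg _ ((coeff_mul_single_one x a 1).trans (by rw [one_smul]))

/-- Conjugation permutes the group and fixes its neutral element. Multiplication by g on one side
alone would move the coefficient. -/
theorem coeffOne_conj (g : G) (x : SkewMonoidAlgebra A G) :
    coeffOne K A G (grp A g * x * grp A g⁻¹) = grp A g * coeffOne K A G x * grp A g⁻¹ := by
  rw [coeffOne_apply, coeffOne_apply, grp_mul_incl, mul_assoc (incl K A G _),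
    grp_mul_inv, mul_one, grp_apply, grp_apply, coeff_mul_single, coeff_single_mul]
  simp

theorem grp_mul_coeffOne (g : G) (x : SkewMonoidAlgebra A G) :
    grp A g * coeffOne K A G (grp A g⁻¹ * x) = single g (x.coeff g) := by
  rw [coeffOne_apply, grp_mul_incl, incl_mul_grp, grp_apply, coeff_single_mul]
  simp

/-- The decomposition of the skew group algebra into the pieces g A: shifting by g⁻¹ brings the
piece of g to the neutral element, where it can be read off. -/
theorem sum_grp_mul_coeffOne [Fintype G] (x : SkewMonoidAlgebra A G) :
    ∑ g, grp A g * coeffOne K A G (grp A g⁻¹ * x) = x := by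
  induction x using SkewMonoidAlgebra.induction_on with
  | zero => simp
  | single h a =>
    simp_rw [grp_mul_coeffOne, coeff_single]
    rw [Finset.sum_eq_single h]
    · rw [Finsupp.single_eq_same]
    · intro g _ hg
      rw [Finsupp.single_eq_of_ne hg, single_zero]
    · simp
  | add x y hx hy => simp only [mul_add, map_add, Finset.sum_add_distrib, hx, hy]

end SkewMonoidAlgebra

/-! ### Constructing double derivations -/

namespace Env

variable {K : Type u} {B : Type v} [CommRing K] [Ring B] [Algebra K B]

/-- The outer left action. -/
instance : Module B (Env K B) := Module.compHom _ (left K : B →ₐ[K] Env K B).toRingHom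

variable (K B) in
/-- The inclusion of the second factor. -/
def rightHom : Bᵐᵒᵖ →+* Env K B where
  toFun b := right K b.unop
  map_one' := right_one
  map_mul' a b := right_mul b.unop a.unop
  map_zero' := map_zero (right K)
  map_add' a b := map_add (right K) a.unop b.unop

/-- The outer right action. -/
instance : Module Bᵐᵒᵖ (Env K B) := Module.compHom _ (rightHom K B)

theorem smul_def (b : B) (r : Env K B) : b • r = left K b * r := rfl

theorem op_smul_def (b : B) (r : Env K B) : op b • r = right K b * r := rfl

instance : SMulCommClass B Bᵐᵒᵖ (Env K B) where
  smul_comm a b r := by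
    obtain ⟨b, rfl⟩ := op_surjective b
    simp only [smul_def, op_smul_def, right_mul_left_mul]

instance : IsScalarTower K B (Env K B) where
  smul_assoc c b r := by simp only [smul_def, map_smul, smul_mul_assoc]

instance : IsScalarTower K Bᵐᵒᵖ (Env K B) where
  smul_assoc c b r := by
    obtain ⟨b, rfl⟩ := op_surjective b
    rw [← op_smul]
    simp only [op_smul_def, map_smul, smul_mul_assoc]

end Env

namespace doubleDerivation

open Env

section

variable {K : Type u} {B : Type v} [CommRing K] [Ring B] [Algebra K B]

/-- The double derivation given by a section of the square zero extension. -/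
def ofAlgHom (F : B →ₐ[K] TrivSqZeroExt B (Env K B)) (hF : ∀ b, (F b).fst = b) :
    doubleDerivation K B :=
  ⟨(TrivSqZeroExt.sndHom B (Env K B)).restrictScalars K ∘ₗ F.toLinearMap, fun a b => by
    change (F (a * b)).snd = left K a * (F b).snd + right K b * (F a).snd
    rw [_root_.map_mul, TrivSqZeroExt.snd_mul, hF, hF]
    rfl⟩

/-- The elements on which two double derivations agree. -/
def eqLocus (δ ε : doubleDerivation K B) : Subalgebra K B where
  carrier := {b | δ.1 b = ε.1 b}
  mul_mem' {a b} ha hb := by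
    have ha' : δ.1 a = ε.1 a := ha
    have hb' : δ.1 b = ε.1 b := hb
    change δ.1 (a * b) = ε.1 (a * b)
    rw [map_mul, map_mul, ha', hb']
  add_mem' {a b} ha hb := by
    have ha' : δ.1 a = ε.1 a := ha
    have hb' : δ.1 b = ε.1 b := hb
    change δ.1 (a + b) = ε.1 (a + b)
    rw [map_add, map_add, ha', hb']
  algebraMap_mem' c := by
    change δ.1 _ = ε.1 _
    rw [Algebra.algebraMap_eq_smul_one, map_smul, map_smul, map_one, map_one]

end

end doubleDerivation

/-! ### The skew group algebra of a path algebra -/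

/-- The skew group algebra of a path algebra. -/
abbrev SkewPathAlgebra (K : Type u) (V : Type v) (G : Type x) [CommRing K] [Quiver.{w} V]
    [Fintype V] [Group G] [QuiverAction G V] : Type (max u v w x) :=
  SkewMonoidAlgebra (PathAlgebra K V) G

namespace SkewPathAlgebra

open PathAlgebra SkewMonoidAlgebra Env

variable (K : Type u) {V : Type v} (G : Type x) [CommRing K] [Quiver.{w} V] [Fintype V]
  [Group G] [QuiverAction G V]

/-- A trivial path. -/
def vtx (i : V) : SkewPathAlgebra K V G := incl K _ G (vertex K i)

/-- An arrow. -/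
def arr (α : QuiverArrow V) : SkewPathAlgebra K V G := incl K _ G (ofArrow K α)

variable (V) in
/-- A group element. -/
def gp : G →* SkewPathAlgebra K V G := grp (PathAlgebra K V)

variable {K G}

theorem subalgebra_eq_top {S : Subalgebra K (SkewPathAlgebra K V G)} (hv : ∀ i, vtx K G i ∈ S)
    (ha : ∀ α, arr K G α ∈ S) (hg : ∀ g, gp K V G g ∈ S) : S = ⊤ := by
  have h : S.comap (incl K _ G) = ⊤ := PathAlgebra.subalgebra_eq_top hv ha
  refine SkewMonoidAlgebra.subalgebra_eq_top (fun a => ?_) hg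
  have ha : a ∈ S.comap (incl K _ G) := h ▸ Algebra.mem_top
  exact ha

theorem algHom_ext {C : Type*} [Ring C] [Algebra K C] {f f' : SkewPathAlgebra K V G →ₐ[K] C}
    (hv : ∀ i, f (vtx K G i) = f' (vtx K G i)) (ha : ∀ α, f (arr K G α) = f' (arr K G α))
    (hg : ∀ g, f (gp K V G g) = f' (gp K V G g)) : f = f' := by
  have h : AlgHom.equalizer f f' = ⊤ := subalgebra_eq_top hv ha hg
  ext x
  have hx : x ∈ AlgHom.equalizer f f' := h ▸ Algebra.mem_top
  exact hx

theorem derivation_ext {δ ε : doubleDerivation K (SkewPathAlgebra K V G)}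
    (hv : ∀ i, δ.1 (vtx K G i) = ε.1 (vtx K G i)) (ha : ∀ α, δ.1 (arr K G α) = ε.1 (arr K G α))
    (hg : ∀ g, δ.1 (gp K V G g) = ε.1 (gp K V G g)) : δ = ε := by
  have h : doubleDerivation.eqLocus δ ε = ⊤ := subalgebra_eq_top hv ha hg
  ext x
  have hx : x ∈ doubleDerivation.eqLocus δ ε := h ▸ Algebra.mem_top
  exact hx

theorem vtx_mul_self (i : V) : vtx K G i * vtx K G i = vtx K G i := by
  rw [vtx, ← map_mul, vertex_mul_self]

theorem vtx_mul_of_ne {i j : V} (h : i ≠ j) : vtx K G i * vtx K G j = 0 := by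
  rw [vtx, vtx, ← map_mul, vertex_mul_of_ne h, map_zero]

theorem sum_vtx : ∑ i : V, vtx K G i = 1 := by
  simp_rw [vtx]
  rw [← _root_.map_sum, sum_vertex, map_one]

theorem arr_mul_vtx (α : QuiverArrow V) : arr K G α * vtx K G α.src = arr K G α := by
  rw [arr, vtx, ← map_mul, ofArrow_mul_vertex]

theorem vtx_mul_arr (α : QuiverArrow V) : vtx K G α.tgt * arr K G α = arr K G α := by
  rw [arr, vtx, ← map_mul, vertex_mul_ofArrow]

theorem gp_mul_arr (g : G) (α : QuiverArrow V) :
    gp K V G g * arr K G α = arr K G (g • α) * gp K V G g := by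
  rw [arr, gp, grp_mul_incl, smul_ofArrow]
  rfl

theorem gp_mul_vtx (g : G) (i : V) : gp K V G g * vtx K G i =
    vtx K G ((QuiverAction.act g : V ⥤q V).obj i) * gp K V G g := by
  rw [vtx, gp, grp_mul_incl, smul_vertex]
  rfl

theorem gp_mul_inv (g : G) : gp K V G g * gp K V G g⁻¹ = 1 := grp_mul_inv g

theorem gp_inv_mul (g : G) : gp K V G g⁻¹ * gp K V G g = 1 := grp_inv_mul g

/-! ### Homomorphisms out of the skew group algebra of a path algebra -/

section Lift

variable {C : Type*} [Ring C] [Algebra K C] {e : V → C} {a : QuiverArrow V → C} {u : G →* C}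

/-- For fixed g, the elements that satisfy the intertwining relation form a subalgebra, as G acts by
algebra automorphisms. -/
theorem smul_comm_of_generators {f : PathAlgebra K V →ₐ[K] C}
    (hv : ∀ g i, f (g • vertex K i) * u g = u g * f (vertex K i))
    (ha : ∀ g α, f (g • ofArrow K α) * u g = u g * f (ofArrow K α))
    {x : PathAlgebra K V} {g : G} : f (g • x) * u g = u g * f x := by
  let S : Subalgebra K (PathAlgebra K V) :=
    { carrier := {x | f (g • x) * u g = u g * f x}
      mul_mem' := fun {x y} hx hy => by
        have hx' : f (g • x) * u g = u g * f x := hx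
        have hy' : f (g • y) * u g = u g * f y := hy
        change f (g • (x * y)) * u g = u g * f (x * y)
        rw [smul_mul', map_mul, map_mul, mul_assoc, hy', ← mul_assoc, hx', mul_assoc]
      add_mem' := fun {x y} hx hy => by
        have hx' : f (g • x) * u g = u g * f x := hx
        have hy' : f (g • y) * u g = u g * f y := hy
        change f (g • (x + y)) * u g = u g * f (x + y)
        rw [smul_add, map_add, map_add, add_mul, mul_add, hx', hy']
      algebraMap_mem' := fun c => by
        change f (g • algebraMap K _ c) * u g = u g * f (algebraMap K _ c)
        rw [Algebra.algebraMap_eq_smul_one, smul_comm, smul_one, ← Algebra.algebraMap_eq_smul_one,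
          f.commutes, Algebra.commutes] }
  have hS : S = ⊤ := PathAlgebra.subalgebra_eq_top (hv g) (ha g)
  have hx : x ∈ S := hS ▸ Algebra.mem_top
  exact hx

theorem lift_smul_comm (he : ∀ i, e i * e i = e i) (hne : ∀ i j, i ≠ j → e i * e j = 0)
    (h1 : ∑ i, e i = 1) (has : ∀ α, a α * e α.src = a α) (hat : ∀ α, e α.tgt * a α = a α)
    (hv : ∀ g i, e ((QuiverAction.act g : V ⥤q V).obj i) * u g = u g * e i)
    (ha : ∀ (g : G) α, a (g • α) * u g = u g * a α) {x : PathAlgebra K V} {g : G} :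
    PathAlgebra.lift K he hne h1 hat (g • x) * u g =
      u g * PathAlgebra.lift K he hne h1 hat x :=
  smul_comm_of_generators
    (fun g i => by rw [smul_vertex, lift_vertex, lift_vertex, hv])
    (fun g α => by
      rw [smul_ofArrow, lift_ofArrow _ _ _ _ (has _), lift_ofArrow _ _ _ _ (has _), ha])

variable (K) in
/-- The algebra homomorphism from the skew group algebra of a path algebra given by the images of
the generators. -/
def lift (he : ∀ i, e i * e i = e i) (hne : ∀ i j, i ≠ j → e i * e j = 0) (h1 : ∑ i, e i = 1)
    (has : ∀ α, a α * e α.src = a α) (hat : ∀ α, e α.tgt * a α = a α)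
    (hv : ∀ g i, e ((QuiverAction.act g : V ⥤q V).obj i) * u g = u g * e i)
    (ha : ∀ (g : G) α, a (g • α) * u g = u g * a α) : SkewPathAlgebra K V G →ₐ[K] C :=
  liftNCAlgHom (PathAlgebra.lift K he hne h1 hat) u (lift_smul_comm he hne h1 has hat hv ha)

variable (he : ∀ i, e i * e i = e i) (hne : ∀ i j, i ≠ j → e i * e j = 0) (h1 : ∑ i, e i = 1)
    (has : ∀ α, a α * e α.src = a α) (hat : ∀ α, e α.tgt * a α = a α)
    (hv : ∀ g i, e ((QuiverAction.act g : V ⥤q V).obj i) * u g = u g * e i)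
    (ha : ∀ (g : G) α, a (g • α) * u g = u g * a α)

theorem lift_vtx (i : V) : lift K he hne h1 has hat hv ha (vtx K G i) = e i := by
  rw [lift, vtx, liftNCAlgHom_incl, lift_vertex]

theorem lift_arr (α : QuiverArrow V) : lift K he hne h1 has hat hv ha (arr K G α) = a α := by
  rw [lift, arr, liftNCAlgHom_incl, lift_ofArrow _ _ _ _ (has α)]

theorem lift_gp (g : G) : lift K he hne h1 has hat hv ha (gp K V G g) = u g := by
  rw [lift, gp, liftNCAlgHom_grp]

end Lift

/-! ### Double derivations prescribed on generators -/

section Derivation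

/-- A derivation is the same as an algebra section of the square zero extension by the bimodule, so
it can be built from the universal property of the algebra. The three hypotheses are the second
components of the relations that involve arrows. -/
theorem exists_derivation (D : QuiverArrow V → Env K (SkewPathAlgebra K V G))
    (ht : ∀ α, left K (vtx K G α.tgt) * D α = D α) (hs : ∀ α, right K (vtx K G α.src) * D α = D α)
    (hg : ∀ (g : G) α, right K (gp K V G g) * D (g • α) = left K (gp K V G g) * D α) :
    ∃ δ : doubleDerivation K (SkewPathAlgebra K V G), (∀ i, δ.1 (vtx K G i) = 0) ∧
      (∀ α, δ.1 (arr K G α) = D α) ∧ (∀ g, δ.1 (gp K V G g) = 0) := by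
  let C := TrivSqZeroExt (SkewPathAlgebra K V G) (Env K (SkewPathAlgebra K V G))
  let j : SkewPathAlgebra K V G →ₐ[K] C := TrivSqZeroExt.inlAlgHom K _ _
  let e : V → C := fun i => j (vtx K G i)
  let a : QuiverArrow V → C := fun α => j (arr K G α) + TrivSqZeroExt.inr (D α)
  let u : G →* C := (j : _ →* C).comp (gp K V G)
  have hl : ∀ b m, j b * TrivSqZeroExt.inr m = TrivSqZeroExt.inr (left K b * m) :=
    fun b m => TrivSqZeroExt.inl_mul_inr b m
  have hr : ∀ b m, TrivSqZeroExt.inr m * j b = TrivSqZeroExt.inr (right K b * m) :=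
    fun b m => TrivSqZeroExt.inr_mul_inl b m
  have he : ∀ i, e i * e i = e i := fun i => by
    change j _ * j _ = j _
    rw [← map_mul, vtx_mul_self]
  have hne : ∀ i j, i ≠ j → e i * e j = 0 := fun i i' h => by
    change j _ * j _ = 0
    rw [← map_mul, vtx_mul_of_ne h, map_zero]
  have h1 : ∑ i, e i = 1 := by
    change ∑ i, j (vtx K G i) = 1
    rw [← _root_.map_sum, sum_vtx, map_one]
  have has : ∀ α, a α * e α.src = a α := fun α => by
    change (j _ + _) * j _ = j _ + _
    rw [add_mul, ← map_mul, arr_mul_vtx, hr, hs]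
  have hat : ∀ α, e α.tgt * a α = a α := fun α => by
    change j _ * (j _ + _) = j _ + _
    rw [mul_add, ← map_mul, vtx_mul_arr, hl, ht]
  have hv : ∀ g i, e ((QuiverAction.act g : V ⥤q V).obj i) * u g = u g * e i := fun g i => by
    change j _ * j _ = j _ * j _
    rw [← map_mul, ← map_mul, gp_mul_vtx]
  have ha : ∀ (g : G) α, a (g • α) * u g = u g * a α := fun g α => by
    change (j _ + _) * j _ = j _ * (j _ + _)
    rw [add_mul, mul_add, ← map_mul, ← map_mul, gp_mul_arr, hl, hr, hg]
  let F : SkewPathAlgebra K V G →ₐ[K] C := lift K he hne h1 has hat hv ha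
  -- That `F` is a section can be tested on generators.
  have hF : (TrivSqZeroExt.fstHom K _ _).comp F = AlgHom.id K _ := by
    refine algHom_ext (fun i => ?_) (fun α => ?_) (fun g => ?_)
    · exact congrArg TrivSqZeroExt.fst (lift_vtx he hne h1 has hat hv ha i)
    · refine (congrArg TrivSqZeroExt.fst (lift_arr he hne h1 has hat hv ha α)).trans ?_
      exact (TrivSqZeroExt.fst_add _ _).trans (add_zero _)
    · exact congrArg TrivSqZeroExt.fst (lift_gp he hne h1 has hat hv ha g)
  refine ⟨doubleDerivation.ofAlgHom F fun b => congr($hF b), fun i => ?_, fun α => ?_, fun g => ?_⟩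
  · exact congrArg TrivSqZeroExt.snd (lift_vtx he hne h1 has hat hv ha i)
  · refine (congrArg TrivSqZeroExt.snd (lift_arr he hne h1 has hat hv ha α)).trans ?_
    exact (TrivSqZeroExt.snd_add _ _).trans (zero_add _)
  · exact congrArg TrivSqZeroExt.snd (lift_gp he hne h1 has hat hv ha g)

end Derivation

end SkewPathAlgebra

/-! ### Double derivations of the skew group algebra of a path algebra -/

namespace SkewPathAlgebra

open PathAlgebra SkewMonoidAlgebra Env

variable {K : Type u} {V : Type v} {G : Type x} [CommRing K] [Quiver.{w} V] [Fintype V]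
  [Group G] [QuiverAction G V]

/-! ### Projection to the neutral coefficient of the first factor -/

section Projection

variable (K V G) in
/-- The projection of the first tensor factor to the coefficient of the neutral element. -/
def proj : Env K (SkewPathAlgebra K V G) →ₗ[K] Env K (SkewPathAlgebra K V G) :=
  Env.lift ((LinearMap.mul K (Env K (SkewPathAlgebra K V G))).compl₁₂
    ((left K).toLinearMap.comp (coeffOne K _ G)) (right K))

theorem proj_apply (a b : SkewPathAlgebra K V G) :
    proj K V G (left K a * right K b) = left K (coeffOne K _ G a) * right K b :=
  Env.lift_apply _ _ _

theorem proj_left (a : SkewPathAlgebra K V G) :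
    proj K V G (left K a) = left K (coeffOne K _ G a) := by
  have h := proj_apply (K := K) a 1
  rwa [right_one, mul_one, mul_one] at h

theorem proj_incl_mul (a : PathAlgebra K V) (r : Env K (SkewPathAlgebra K V G)) :
    proj K V G (left K (incl K _ G a) * r) = left K (incl K _ G a) * proj K V G r := by
  induction r using Env.induction with
  | h b c => rw [← mul_assoc, ← map_mul, proj_apply, coeffOne_incl_mul, proj_apply, map_mul,
      mul_assoc]
  | hadd r s hr hs => rw [mul_add, map_add, map_add, hr, hs, mul_add]

theorem proj_right_mul (a : SkewPathAlgebra K V G) (r : Env K (SkewPathAlgebra K V G)) :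
    proj K V G (right K a * r) = right K a * proj K V G r := by
  induction r using Env.induction with
  | h b c => rw [right_mul_left_mul, ← right_mul, proj_apply, proj_apply, right_mul,
      right_mul_left_mul]
  | hadd r s hr hs => rw [mul_add, map_add, map_add, hr, hs, mul_add]

theorem proj_mul_incl (a : PathAlgebra K V) (r : Env K (SkewPathAlgebra K V G)) :
    proj K V G (r * left K (incl K _ G a)) = proj K V G r * left K (incl K _ G a) := by
  induction r using Env.induction with
  | h b c => rw [mul_assoc, right_mul_left, ← mul_assoc, ← map_mul, proj_apply, coeffOne_mul_incl,
      proj_apply, map_mul, mul_assoc, mul_assoc, right_mul_left]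
  | hadd r s hr hs => rw [add_mul, map_add, map_add, hr, hs, add_mul]

theorem proj_mul_right (a : SkewPathAlgebra K V G) (r : Env K (SkewPathAlgebra K V G)) :
    proj K V G (r * right K a) = proj K V G r * right K a := by
  induction r using Env.induction with
  | h b c => rw [mul_assoc, ← right_mul, proj_apply, proj_apply, right_mul, mul_assoc]
  | hadd r s hr hs => rw [add_mul, map_add, map_add, hr, hs, add_mul]

/-- The projection does not commute with multiplying the first factor by g on one side; this
conjugation formula is the substitute used for the right module structure. -/
theorem proj_conj (g : G) (r : Env K (SkewPathAlgebra K V G)) :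
    proj K V G (left K (gp K V G g) * r * left K (gp K V G g⁻¹)) =
      left K (gp K V G g) * proj K V G r * left K (gp K V G g⁻¹) := by
  induction r using Env.induction with
  | h b c =>
    rw [mul_assoc, mul_assoc (left K b), right_mul_left, ← mul_assoc, ← mul_assoc, ← map_mul,
      ← map_mul, proj_apply]
    refine (congrArg (fun y => left K y * right K c) (coeffOne_conj g b)).trans ?_
    rw [proj_apply, map_mul, map_mul, mul_assoc, mul_assoc, mul_assoc, mul_assoc, right_mul_left]
    rfl
  | hadd r s hr hs => simp only [mul_add, add_mul, map_add, hr, hs]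

/-- This expresses that B ⊗ B is an induced G-module. It takes the place of averaging and needs no
division by the order of G. -/
theorem sum_proj [Fintype G] (r : Env K (SkewPathAlgebra K V G)) :
    ∑ g, left K (gp K V G g) * proj K V G (left K (gp K V G g⁻¹) * r) = r := by
  induction r using Env.induction with
  | h b c =>
    simp_rw [← mul_assoc, ← map_mul, proj_apply, ← mul_assoc, ← map_mul]
    rw [← Finset.sum_mul, ← _root_.map_sum]
    exact congrArg (fun y => left K y * right K c) (sum_grp_mul_coeffOne b)
  | hadd r s hr hs => simp only [mul_add, map_add, Finset.sum_add_distrib, hr, hs]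

end Projection

/-! ### Conjugation elements and idempotents of arrows -/

section Conj

variable (K V G) in
/-- The element `g ⊗ g⁻¹`. -/
def conj : G →* Env K (SkewPathAlgebra K V G) where
  toFun g := left K (gp K V G g) * right K (gp K V G g⁻¹)
  map_one' := by rw [inv_one, map_one, map_one, right_one, one_mul]
  map_mul' g h := by
    rw [mul_inv_rev, map_mul, map_mul, map_mul, right_mul, mul_assoc, mul_assoc,
      right_mul_left_mul]

theorem conj_apply (g : G) :
    conj K V G g = left K (gp K V G g) * right K (gp K V G g⁻¹) := rfl

theorem conj_mul_right_gp (g : G) :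
    conj K V G g * right K (gp K V G g) = left K (gp K V G g) := by
  rw [conj_apply, mul_assoc, ← right_mul, gp_mul_inv, right_one, mul_one]

theorem right_gp_mul_conj (g : G) :
    right K (gp K V G g) * conj K V G g = left K (gp K V G g) := by
  rw [conj_apply, right_mul_left_mul, ← right_mul, gp_inv_mul, right_one, mul_one]

theorem conj_mul_left (g : G) {a b : SkewPathAlgebra K V G}
    (h : gp K V G g * a = b * gp K V G g) :
    conj K V G g * left K a = left K b * conj K V G g := by
  rw [conj_apply, mul_assoc, right_mul_left, ← mul_assoc, ← mul_assoc, ← map_mul, ← map_mul, h]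

theorem conj_mul_right (g : G) {a b : SkewPathAlgebra K V G}
    (h : gp K V G g * a = b * gp K V G g) :
    conj K V G g * right K a = right K b * conj K V G g := by
  have h' : a * gp K V G g⁻¹ = gp K V G g⁻¹ * b := by
    rw [← one_mul a, ← gp_inv_mul g, mul_assoc (gp K V G g⁻¹), h, mul_assoc, mul_assoc,
      gp_mul_inv, mul_one]
  rw [conj_apply, mul_assoc, ← right_mul, right_mul_left_mul, ← right_mul, h']

/-- The idempotent `e ⊗ e'` where `e` and `e'` are the trivial paths at the target and source
of an arrow. -/
def idem (α : QuiverArrow V) : Env K (SkewPathAlgebra K V G) :=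
  left K (vtx K G α.tgt) * right K (vtx K G α.src)

theorem left_mul_idem (α : QuiverArrow V) :
    left K (vtx K G α.tgt) * (idem α : Env K (SkewPathAlgebra K V G)) = idem α := by
  rw [idem, ← mul_assoc, ← map_mul, vtx_mul_self]

theorem idem_mul_left (α : QuiverArrow V) :
    (idem α : Env K (SkewPathAlgebra K V G)) * left K (vtx K G α.tgt) = idem α := by
  rw [idem, mul_assoc, right_mul_left, ← mul_assoc, ← map_mul, vtx_mul_self]

theorem right_mul_idem (α : QuiverArrow V) :
    right K (vtx K G α.src) * (idem α : Env K (SkewPathAlgebra K V G)) = idem α := by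
  rw [idem, right_mul_left_mul, ← right_mul, vtx_mul_self]

theorem idem_mul_right (α : QuiverArrow V) :
    (idem α : Env K (SkewPathAlgebra K V G)) * right K (vtx K G α.src) = idem α := by
  rw [idem, mul_assoc, ← right_mul, vtx_mul_self]

theorem conj_mul_idem (g : G) (α : QuiverArrow V) :
    conj K V G g * idem α = idem (g • α) * conj K V G g := by
  rw [idem, ← mul_assoc, conj_mul_left g (gp_mul_vtx g _), mul_assoc,
    conj_mul_right g (gp_mul_vtx g _), ← mul_assoc]
  rfl

-- Apply δ to α = e α = α e', where e and e' are the trivial paths at the target and source; these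
-- are killed by δ.
variable (G) in
theorem idem_mul_apply {δ : doubleDerivation K (SkewPathAlgebra K V G)}
    (hv : ∀ i, δ.1 (vtx K G i) = 0) (α : QuiverArrow V) :
    idem α * δ.1 (arr K G α) = δ.1 (arr K G α) := by
  have h1 : left K (vtx K G α.tgt) * δ.1 (arr K G α) = δ.1 (arr K G α) := by
    conv_rhs => rw [← vtx_mul_arr, doubleDerivation.map_mul, hv, mul_zero, add_zero]
  have h2 : right K (vtx K G α.src) * δ.1 (arr K G α) = δ.1 (arr K G α) := by
    conv_rhs => rw [← arr_mul_vtx, doubleDerivation.map_mul, hv, mul_zero, zero_add]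
  rw [idem, mul_assoc, h2, h1]

/-- Equivariance of the values on arrows, obtained by applying δ to the relation g α = (g α) g in
the skew group algebra. -/
theorem conj_mul_apply {δ : doubleDerivation K (SkewPathAlgebra K V G)}
    (hg : ∀ g, δ.1 (gp K V G g) = 0) (g : G) (α : QuiverArrow V) :
    conj K V G g * δ.1 (arr K G α) = δ.1 (arr K G (g • α)) := by
  have h1 : left K (gp K V G g) * δ.1 (arr K G α) =
      right K (gp K V G g) * δ.1 (arr K G (g • α)) := by
    have h := congrArg δ.1 (gp_mul_arr (K := K) g α)
    rwa [doubleDerivation.map_mul, doubleDerivation.map_mul, hg, mul_zero, mul_zero, add_zero,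
      zero_add] at h
  rw [conj_apply, mul_assoc, ← right_mul_left_mul, h1, ← mul_assoc, ← right_mul, gp_mul_inv,
    right_one, one_mul]

end Conj

/-! ### Normalization modulo inner derivations -/

section Normalize

/-- The restriction of δ to G is a 1-cocycle with values in an induced module, hence a coboundary.
The witness is the usual contracting homotopy, the sum of g⁻¹ `proj` (δ(g)). -/
theorem exists_eq_inner_on_gp [Fintype G] (δ : doubleDerivation K (SkewPathAlgebra K V G)) :
    ∃ r, ∀ g, δ.1 (gp K V G g) = (doubleDerivation.inner K _ r).1 (gp K V G g) := by
  refine ⟨∑ g, left K (gp K V G g⁻¹) * proj K V G (δ.1 (gp K V G g)), fun h => ?_⟩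
  rw [doubleDerivation.inner_apply, eq_sub_iff_add_eq, Finset.mul_sum, Finset.mul_sum]
  conv_lhs => rw [← sum_proj (δ.1 (gp K V G h)), ← Equiv.sum_comp (Equiv.inv G)]
  -- Replacing g by g h turns h g⁻¹ into g⁻¹ and δ(g) into δ(g h), to which the Leibniz rule
  -- applies.
  rw [← Finset.sum_add_distrib, ← Equiv.sum_comp (Equiv.mulRight h) (fun g =>
    left K (gp K V G h) * (left K (gp K V G g⁻¹) * proj K V G (δ.1 (gp K V G g))))]
  refine Finset.sum_congr rfl fun g _ => ?_
  rw [Equiv.inv_apply, Equiv.coe_mulRight, inv_inv, right_mul_left_mul, ← mul_add,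
    ← proj_right_mul, ← map_add, ← mul_assoc, ← map_mul, ← map_mul, mul_inv_rev,
    mul_inv_cancel_left, map_mul (gp K V G), doubleDerivation.map_mul]

/-- The trivial paths span a separable algebra with separability idempotent ∑ e_i ⊗ e_i, and the
witness is the resulting primitive, up to sign. As G permutes the vertices, the witness is
G-invariant, so its inner derivation does not spoil the vanishing on G. -/
theorem exists_eq_inner_on_vtx (δ : doubleDerivation K (SkewPathAlgebra K V G))
    (hg : ∀ g, δ.1 (gp K V G g) = 0) :
    ∃ r, (∀ i, δ.1 (vtx K G i) = (doubleDerivation.inner K _ r).1 (vtx K G i)) ∧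
      ∀ g, (doubleDerivation.inner K _ r).1 (gp K V G g) = 0 := by
  refine ⟨-∑ i, right K (vtx K G i) * δ.1 (vtx K G i), fun j => ?_, fun g => ?_⟩
  -- This is the Leibniz rule for e_j e_i. Summed over i, the first term leaves only i = j, and the
  -- trivial paths in the second add up to 1.
  · have h : ∀ i, left K (vtx K G j) * (right K (vtx K G i) * δ.1 (vtx K G i)) =
        right K (vtx K G i) * δ.1 (vtx K G j * vtx K G i) -
          right K (vtx K G i) * δ.1 (vtx K G j) := by
      intro i
      rw [doubleDerivation.map_mul, mul_add, ← mul_assoc (right K (vtx K G i)) (right K _),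
        ← right_mul, vtx_mul_self, right_mul_left_mul]
      abel
    rw [doubleDerivation.inner_apply, mul_neg, mul_neg, Finset.mul_sum, Finset.mul_sum]
    simp_rw [h]
    rw [Finset.sum_sub_distrib, ← Finset.sum_mul, ← _root_.map_sum, sum_vtx, right_one, one_mul,
      Finset.sum_eq_single j, Finset.sum_eq_single j, ← mul_assoc, ← right_mul, vtx_mul_self]
    · abel
    · intro i _ hi
      rw [← mul_assoc, ← right_mul, vtx_mul_of_ne hi, map_zero, zero_mul]
    · simp
    · intro i _ hi
      rw [vtx_mul_of_ne (Ne.symm hi), map_zero, mul_zero]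
    · simp
  · have h : ∀ i, left K (gp K V G g) * δ.1 (vtx K G i) = right K (gp K V G g) *
        δ.1 (vtx K G ((QuiverAction.act g : V ⥤q V).obj i)) := by
      intro i
      have h := congrArg δ.1 (gp_mul_vtx (K := K) g i)
      rwa [doubleDerivation.map_mul, doubleDerivation.map_mul, hg, mul_zero, mul_zero, add_zero,
        zero_add] at h
    rw [doubleDerivation.inner_apply, mul_neg, mul_neg, neg_sub_neg, sub_eq_zero, Finset.mul_sum,
      Finset.mul_sum]
    refine (Fintype.sum_bijective _ (obj_bijective g) _ _ fun i => ?_).symm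
    rw [← right_mul_left_mul, h, ← mul_assoc, ← mul_assoc, ← right_mul, ← right_mul, gp_mul_vtx]

theorem exists_normalized [Fintype G] (δ : doubleDerivation K (SkewPathAlgebra K V G)) :
    ∃ (r : _) (ε : doubleDerivation K (SkewPathAlgebra K V G)),
      δ = ε + doubleDerivation.inner K _ r ∧
      (∀ i, ε.1 (vtx K G i) = 0) ∧ ∀ g, ε.1 (gp K V G g) = 0 := by
  obtain ⟨r, hr⟩ := exists_eq_inner_on_gp δ
  have hr' : ∀ g, (δ - doubleDerivation.inner K _ r).1 (gp K V G g) = 0 := fun g =>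
    sub_eq_zero.2 (hr g)
  obtain ⟨s, hs, hs'⟩ := exists_eq_inner_on_vtx _ hr'
  refine ⟨r + s, δ - doubleDerivation.inner K _ r - doubleDerivation.inner K _ s, ?_, fun i => ?_,
    fun g => ?_⟩
  · ext b
    change δ.1 b = δ.1 b - _ - _ + _
    rw [doubleDerivation.inner_apply, doubleDerivation.inner_apply, doubleDerivation.inner_apply,
      mul_add, mul_add]
    abel
  · exact sub_eq_zero.2 (hs i)
  · exact sub_eq_zero.2 ((hr' g).trans (hs' g).symm)

end Normalize

end SkewPathAlgebra

/-! ### The double derivations dual to the arrows -/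

namespace SkewPathAlgebra

open PathAlgebra SkewMonoidAlgebra Env

variable {K : Type u} {V : Type v} {G : Type x} [CommRing K] [Quiver.{w} V] [Fintype V]
  [Group G] [QuiverAction G V]

theorem derivation_ext_arr {δ ε : doubleDerivation K (SkewPathAlgebra K V G)}
    (hv : ∀ i, δ.1 (vtx K G i) = 0) (hg : ∀ g, δ.1 (gp K V G g) = 0)
    (hv' : ∀ i, ε.1 (vtx K G i) = 0) (hg' : ∀ g, ε.1 (gp K V G g) = 0)
    (ha : ∀ α, δ.1 (arr K G α) = ε.1 (arr K G α)) : δ = ε :=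
  derivation_ext (fun i => (hv i).trans (hv' i).symm) ha fun g => (hg g).trans (hg' g).symm

theorem left_vtx_mul_sum (j : V) :
    left K (vtx K G j) * ∑ i, left K (vtx K G i) * right K (vtx K G i) =
      left K (vtx K G j) * right K (vtx K G j) := by
  rw [Finset.mul_sum, Finset.sum_eq_single j]
  · rw [← mul_assoc, ← map_mul, vtx_mul_self]
  · intro i _ hi
    rw [← mul_assoc, ← map_mul, vtx_mul_of_ne hi.symm, map_zero, zero_mul]
  · simp

theorem right_vtx_mul_sum (j : V) :
    right K (vtx K G j) * ∑ i, left K (vtx K G i) * right K (vtx K G i) =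
      left K (vtx K G j) * right K (vtx K G j) := by
  rw [Finset.mul_sum, Finset.sum_eq_single j]
  · rw [right_mul_left_mul, ← right_mul, vtx_mul_self]
  · intro i _ hi
    rw [right_mul_left_mul, ← right_mul, vtx_mul_of_ne hi, map_zero, mul_zero]
  · simp

/-- Both sides are α ⊗ e with e the trivial path at the source. Together with the next lemma, this
compares the inner derivation of `casimir` with the values of the dual derivations. -/
theorem left_arr_mul_sum (α : QuiverArrow V) :
    left K (arr K G α) * ∑ i, left K (vtx K G i) * right K (vtx K G i) =
      idem α * left K (arr K G α) := by
  conv_lhs => rw [← arr_mul_vtx, map_mul, mul_assoc, left_vtx_mul_sum, ← mul_assoc, ← map_mul,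
    arr_mul_vtx]
  conv_rhs => rw [idem, mul_assoc, right_mul_left, ← mul_assoc, ← map_mul, vtx_mul_arr]

theorem right_arr_mul_sum (α : QuiverArrow V) :
    right K (arr K G α) * ∑ i, left K (vtx K G i) * right K (vtx K G i) =
      idem α * right K (arr K G α) := by
  conv_lhs => rw [← vtx_mul_arr, right_mul, mul_assoc, right_vtx_mul_sum, right_mul_left_mul,
    ← right_mul, vtx_mul_arr]
  conv_rhs => rw [idem, mul_assoc, ← right_mul, arr_mul_vtx]

variable [Fintype G]

open Classical in
variable (K G) in
/-- The sum of the elements `g ⊗ g⁻¹` with `g α = β`. -/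
def transporter (α β : QuiverArrow V) : Env K (SkewPathAlgebra K V G) :=
  ∑ g : G, if g • α = β then conj K V G g else 0

theorem conj_mul_transporter (g : G) (α β : QuiverArrow V) :
    conj K V G g * transporter K G α β = transporter K G α (g • β) := by
  classical
  rw [transporter, transporter, Finset.mul_sum, ← Equiv.sum_comp (Equiv.mulLeft g) (fun h =>
    @ite _ (h • α = g • β) _ (conj K V G h) 0)]
  refine Finset.sum_congr rfl fun h _ => ?_
  rw [Equiv.coe_mulLeft, mul_smul, smul_left_cancel_iff, mul_ite, mul_zero, map_mul]

theorem transporter_mul_conj (g : G) (α β : QuiverArrow V) :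
    transporter K G (g • α) β * conj K V G g = transporter K G α β := by
  classical
  rw [transporter, transporter, Finset.sum_mul, ← Equiv.sum_comp (Equiv.mulRight g) (fun h =>
    @ite _ (h • α = β) _ (conj K V G h) 0)]
  refine Finset.sum_congr rfl fun h _ => ?_
  rw [Equiv.coe_mulRight, mul_smul, ite_mul, zero_mul, map_mul]

/-- The relation is checked term by term, and only for the g that carry α to β. -/
theorem transporter_mul {α β : QuiverArrow V} {r s : Env K (SkewPathAlgebra K V G)}
    (h : ∀ g : G, g • α = β → conj K V G g * r = s * conj K V G g) :
    transporter K G α β * r = s * transporter K G α β := by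
  rw [transporter, Finset.sum_mul, Finset.mul_sum]
  refine Finset.sum_congr rfl fun g _ => ?_
  split_ifs with hg
  · exact h g hg
  · rw [zero_mul, mul_zero]

/-- Each g carries exactly one arrow to β, namely g⁻¹ β. Summing over all arrows avoids orbit
representatives and division by orders of stabilizers. -/
theorem sum_transporter_mul [Fintype (QuiverArrow V)] (β : QuiverArrow V)
    (F : QuiverArrow V → Env K (SkewPathAlgebra K V G)) :
    ∑ α, transporter K G α β * F α = ∑ g : G, conj K V G g * F (g⁻¹ • β) := by
  simp_rw [transporter, Finset.sum_mul]
  rw [Finset.sum_comm]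
  refine Finset.sum_congr rfl fun g _ => ?_
  rw [Finset.sum_eq_single (g⁻¹ • β)]
  · rw [smul_inv_smul, if_pos rfl]
  · intro α _ hα
    rw [if_neg fun h => hα (by rw [← h, inv_smul_smul]), zero_mul]
  · simp

-- The prescribed values have the right end points because of `idem`, and they are equivariant
-- because left translation by g sends the transporters to β to those to g β.
variable (K G) in
theorem exists_dual (α : QuiverArrow V) :
    ∃ δ : doubleDerivation K (SkewPathAlgebra K V G), (∀ i, δ.1 (vtx K G i) = 0) ∧
      (∀ β, δ.1 (arr K G β) = idem β * transporter K G α β) ∧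
      (∀ g, δ.1 (gp K V G g) = 0) := by
  refine exists_derivation _ (fun β => ?_) (fun β => ?_) (fun g β => ?_)
  · rw [← mul_assoc, left_mul_idem]
  · rw [← mul_assoc, right_mul_idem]
  · rw [← conj_mul_transporter, ← mul_assoc (idem _), ← conj_mul_idem, mul_assoc, ← mul_assoc,
      right_gp_mul_conj]

variable (K G) in
/-- The double derivation dual to an arrow. -/
def dual (α : QuiverArrow V) : doubleDerivation K (SkewPathAlgebra K V G) :=
  Classical.choose (exists_dual K G α)

theorem dual_vtx (α : QuiverArrow V) (i : V) : (dual K G α).1 (vtx K G i) = 0 :=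
  (Classical.choose_spec (exists_dual K G α)).1 i

theorem dual_arr (α β : QuiverArrow V) :
    (dual K G α).1 (arr K G β) = idem β * transporter K G α β :=
  (Classical.choose_spec (exists_dual K G α)).2.1 β

theorem dual_gp (α : QuiverArrow V) (g : G) : (dual K G α).1 (gp K V G g) = 0 :=
  (Classical.choose_spec (exists_dual K G α)).2.2 g

theorem mulRight_dual_vtx (α : QuiverArrow V) (r : Env K (SkewPathAlgebra K V G)) (i : V) :
    (doubleDerivation.mulRight (dual K G α) r).1 (vtx K G i) = 0 := by
  rw [doubleDerivation.mulRight_apply, dual_vtx, zero_mul]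

theorem mulRight_dual_gp (α : QuiverArrow V) (r : Env K (SkewPathAlgebra K V G)) (g : G) :
    (doubleDerivation.mulRight (dual K G α) r).1 (gp K V G g) = 0 := by
  rw [doubleDerivation.mulRight_apply, dual_gp, zero_mul]

/-- In the bimodule of classes, this says that α^* ends at the source of α; the next lemma says that
it starts at the target. -/
theorem dual_mulRight_right_vtx (α : QuiverArrow V) :
    doubleDerivation.mulRight (dual K G α) (right K (vtx K G α.src)) = dual K G α := by
  refine derivation_ext_arr (mulRight_dual_vtx _ _) (mulRight_dual_gp _ _) (dual_vtx _) (dual_gp _)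
    fun β => ?_
  rw [doubleDerivation.mulRight_apply, dual_arr, mul_assoc,
    transporter_mul (s := right K (vtx K G β.src)), ← mul_assoc, idem_mul_right]
  rintro g rfl
  exact conj_mul_right g (gp_mul_vtx g _)

theorem dual_mulRight_left_vtx (α : QuiverArrow V) :
    doubleDerivation.mulRight (dual K G α) (left K (vtx K G α.tgt)) = dual K G α := by
  refine derivation_ext_arr (mulRight_dual_vtx _ _) (mulRight_dual_gp _ _) (dual_vtx _) (dual_gp _)
    fun β => ?_
  rw [doubleDerivation.mulRight_apply, dual_arr, mul_assoc,
    transporter_mul (s := left K (vtx K G β.tgt)), ← mul_assoc, idem_mul_left]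
  rintro g rfl
  exact conj_mul_left g (gp_mul_vtx g _)

/-- This becomes the skew relation g α^* = (g α)^* g in the tensor algebra. -/
theorem dual_mulRight_gp (g : G) (α : QuiverArrow V) :
    doubleDerivation.mulRight (dual K G α) (right K (gp K V G g)) =
      doubleDerivation.mulRight (dual K G (g • α)) (left K (gp K V G g)) := by
  refine derivation_ext_arr (mulRight_dual_vtx _ _) (mulRight_dual_gp _ _) (mulRight_dual_vtx _ _)
    (mulRight_dual_gp _ _) fun β => ?_
  rw [doubleDerivation.mulRight_apply, doubleDerivation.mulRight_apply, dual_arr, dual_arr,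
    mul_assoc, mul_assoc, ← conj_mul_right_gp, ← mul_assoc (transporter K G (g • α) β),
    transporter_mul_conj]

/-- At β the left side becomes the sum of (g ⊗ g⁻¹) `proj` (δ(g⁻¹ β)), up to the idempotent of β.
Equivariance rewrites δ(g⁻¹ β) through δ(β), and what remains is `sum_proj`. -/
theorem sum_dual_mulRight_proj [Fintype (QuiverArrow V)]
    {δ : doubleDerivation K (SkewPathAlgebra K V G)}
    (hv : ∀ i, δ.1 (vtx K G i) = 0) (hg : ∀ g, δ.1 (gp K V G g) = 0) :
    ∑ α, doubleDerivation.mulRight (dual K G α) (proj K V G (δ.1 (arr K G α))) = δ := by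
  have hsum : ∀ b, (∑ α, doubleDerivation.mulRight (dual K G α)
      (proj K V G (δ.1 (arr K G α)))).1 b =
      ∑ α, (dual K G α).1 b * (proj K V G (δ.1 (arr K G α))) := by
    intro b
    rw [Submodule.coe_sum, LinearMap.sum_apply]
    rfl
  refine derivation_ext_arr (fun i => ?_) (fun g => ?_) hv hg fun β => ?_
  · rw [hsum]
    simp [dual_vtx]
  · rw [hsum]
    simp [dual_gp]
  · rw [hsum]
    simp_rw [dual_arr, mul_assoc]
    rw [← Finset.mul_sum, sum_transporter_mul, ← idem_mul_apply G hv β]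
    congr 1
    conv_rhs => rw [← sum_proj (δ.1 (arr K G β))]
    refine Finset.sum_congr rfl fun g _ => ?_
    rw [← conj_mul_apply hg g⁻¹ β, conj_apply, conj_apply, inv_inv, ← right_mul_left (gp K V G g⁻¹),
      mul_assoc, mul_assoc (right K (gp K V G g)), proj_right_mul, ← mul_assoc (right K _),
      ← right_mul, gp_mul_inv, right_one, one_mul]

variable (K V G) in
/-- The sum of the elements `g e_i ⊗ e_i g⁻¹`. -/
def casimir : Env K (SkewPathAlgebra K V G) :=
  (∑ i, left K (vtx K G i) * right K (vtx K G i)) * ∑ g : G, conj K V G g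

/-- G permutes the e_i ⊗ e_i, so g ⊗ g⁻¹ moves past their sum and is absorbed by the sum over the
group. -/
theorem conj_mul_casimir (g : G) : conj K V G g * casimir K V G = casimir K V G := by
  have h1 : conj K V G g * ∑ i, left K (vtx K G i) * right K (vtx K G i) =
      (∑ i, left K (vtx K G i) * right K (vtx K G i)) * conj K V G g := by
    rw [Finset.mul_sum, Finset.sum_mul]
    refine Fintype.sum_bijective _ (obj_bijective g) _ _ fun i => ?_
    rw [← mul_assoc, conj_mul_left g (gp_mul_vtx g i), mul_assoc,
      conj_mul_right g (gp_mul_vtx g i), ← mul_assoc]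
  have h2 : conj K V G g * ∑ h : G, conj K V G h = ∑ h : G, conj K V G h := by
    rw [Finset.mul_sum]
    simp_rw [← map_mul]
    exact Equiv.sum_comp (Equiv.mulLeft g) _
  rw [casimir, ← mul_assoc, h1, mul_assoc, h2]

/-- The reason why the preprojective relation holds in Ext^1. Both sides are normalized, so it
suffices to compare values at an arrow β, where moving g ⊗ g⁻¹ past g⁻¹ β yields a factor β
independent of g. -/
theorem sum_dual_commutator [Fintype (QuiverArrow V)] :
    ∑ α : QuiverArrow V, (doubleDerivation.mulRight (dual K G α) (right K (arr K G α)) -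
      doubleDerivation.mulRight (dual K G α) (left K (arr K G α))) =
      doubleDerivation.inner K _ (-casimir K V G) := by
  have hsum : ∀ b, (∑ α : QuiverArrow V,
      (doubleDerivation.mulRight (dual K G α) (right K (arr K G α)) -
        doubleDerivation.mulRight (dual K G α) (left K (arr K G α)))).1 b =
      ∑ α, ((dual K G α).1 b * right K (arr K G α) - (dual K G α).1 b * left K (arr K G α)) := by
    intro b
    rw [Submodule.coe_sum, LinearMap.sum_apply]
    rfl
  refine derivation_ext_arr (fun i => ?_) (fun g => ?_) (fun i => ?_) (fun g => ?_) fun β => ?_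
  · rw [hsum]
    simp [dual_vtx]
  · rw [hsum]
    simp [dual_gp]
  · rw [doubleDerivation.inner_apply, mul_neg, mul_neg, casimir, ← mul_assoc, ← mul_assoc,
      left_vtx_mul_sum, right_vtx_mul_sum, sub_self]
  · rw [doubleDerivation.inner_apply, ← right_gp_mul_conj, mul_neg, mul_neg, mul_assoc,
      conj_mul_casimir, sub_self]
  · rw [hsum, doubleDerivation.inner_apply, Finset.sum_sub_distrib]
    simp_rw [dual_arr, mul_assoc]
    rw [← Finset.mul_sum, ← Finset.mul_sum, sum_transporter_mul, sum_transporter_mul]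
    have h1 : ∀ g : G, conj K V G g * right K (arr K G (g⁻¹ • β)) =
        right K (arr K G β) * conj K V G g := fun g =>
      conj_mul_right g (by rw [gp_mul_arr, smul_inv_smul])
    have h2 : ∀ g : G, conj K V G g * left K (arr K G (g⁻¹ • β)) =
        left K (arr K G β) * conj K V G g := fun g =>
      conj_mul_left g (by rw [gp_mul_arr, smul_inv_smul])
    simp_rw [h1, h2]
    rw [← Finset.mul_sum, ← Finset.mul_sum, ← mul_assoc, ← mul_assoc, mul_neg, mul_neg, casimir,
      ← mul_assoc, ← mul_assoc, left_arr_mul_sum, right_arr_mul_sum]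
    abel

-- The projection keeps only the term g = 1 of the transporter, which is present only when α = β.
-- This is the sense in which these derivations are dual to the arrows.
open Classical in
theorem proj_dual_arr (α β : QuiverArrow V) : proj K V G ((dual K G α).1 (arr K G β)) =
    if α = β then idem α else 0 := by
  rw [dual_arr, idem, mul_assoc, vtx, proj_incl_mul, proj_right_mul, transporter, _root_.map_sum,
    Finset.sum_eq_single 1]
  · rw [one_smul, map_one]
    split_ifs with h
    · subst h
      have h1 := proj_left (K := K) (V := V) (G := G) 1
      rw [coeffOne_one, map_one] at h1
      rw [h1, mul_one]
      rfl
    · rw [map_zero, mul_zero, mul_zero]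
  · intro g _ hg
    split_ifs
    · have h0 : coeffOne K (PathAlgebra K V) G (gp K V G g) = 0 := by
        have := coeffOne_grp_of_ne (K := K) hg (1 : PathAlgebra K V)
        rwa [map_one, mul_one] at this
      rw [conj_apply, proj_apply, h0, map_zero, zero_mul]
    · exact map_zero _
  · simp

end SkewPathAlgebra

/-! ### The homomorphism from the tensor algebra -/

namespace Env

variable {K : Type u} {B : Type v} {P : Type w} [CommRing K] [Ring B] [Algebra K B] [Ring P]
  [Algebra K P] (f : B →ₐ[K] P)

/-- The linear map `a ⊗ b ↦ b p a`. -/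
def sandwich (p : P) : Env K B →ₗ[K] P :=
  Env.lift ((LinearMap.mul K P).compl₁₂ ((LinearMap.mulRight K p).comp f.toLinearMap)
    f.toLinearMap).flip

theorem sandwich_apply (p : P) (a b : B) :
    sandwich f p (left K a * right K b) = f b * p * f a :=
  Env.lift_apply _ _ _

theorem sandwich_mul_left (p : P) (r : Env K B) (c : B) :
    sandwich f p (r * left K c) = sandwich f p r * f c := by
  induction r using Env.induction with
  | h a b => rw [mul_assoc, right_mul_left, ← mul_assoc, ← map_mul, sandwich_apply,
      sandwich_apply, map_mul, mul_assoc, mul_assoc, mul_assoc]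
  | hadd r s hr hs => rw [add_mul, map_add, map_add, hr, hs, add_mul]

theorem sandwich_mul_right (p : P) (r : Env K B) (c : B) :
    sandwich f p (r * right K c) = f c * sandwich f p r := by
  induction r using Env.induction with
  | h a b =>
    rw [mul_assoc, ← right_mul, sandwich_apply, sandwich_apply, map_mul]
    simp only [mul_assoc]
  | hadd r s hr hs => rw [add_mul, map_add, map_add, hr, hs, mul_add]

theorem sandwich_left_mul (p : P) (r : Env K B) (c : B) :
    sandwich f p (left K c * r) = sandwich f (p * f c) r := by
  induction r using Env.induction with
  | h a b =>
    rw [← mul_assoc, ← map_mul, sandwich_apply, sandwich_apply, map_mul]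
    simp only [mul_assoc]
  | hadd r s hr hs => rw [mul_add, map_add, map_add, hr, hs]

theorem sandwich_right_mul (p : P) (r : Env K B) (c : B) :
    sandwich f p (right K c * r) = sandwich f (f c * p) r := by
  induction r using Env.induction with
  | h a b =>
    rw [right_mul_left_mul, ← right_mul, sandwich_apply, sandwich_apply, map_mul]
    simp only [mul_assoc]
  | hadd r s hr hs => rw [mul_add, map_add, map_add, hr, hs]

theorem sum_sandwich {ι : Type*} (s : Finset ι) (p : ι → P) (r : Env K B) :
    ∑ i ∈ s, sandwich f (p i) r = sandwich f (∑ i ∈ s, p i) r := by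
  induction r using Env.induction with
  | h a b => simp only [sandwich_apply, Finset.mul_sum, Finset.sum_mul]
  | hadd r t hr ht => simp only [map_add, Finset.sum_add_distrib, hr, ht]

theorem sandwich_sub (p p' : P) (r : Env K B) :
    sandwich f (p - p') r = sandwich f p r - sandwich f p' r := by
  induction r using Env.induction with
  | h a b => simp only [sandwich_apply, mul_sub, sub_mul]
  | hadd r t hr ht => rw [map_add, map_add, map_add, hr, ht]; abel

theorem sandwich_zero (r : Env K B) : sandwich f (0 : P) r = 0 := by
  simpa only [sub_self] using sandwich_sub f (0 : P) 0 r

end Env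

namespace doubleDerivation

variable {K : Type u} {B : Type v} [CommRing K] [Ring B] [Algebra K B]

theorem mulRight_add (δ ε : doubleDerivation K B) (r : Env K B) :
    mulRight (δ + ε) r = mulRight δ r + mulRight ε r := by
  ext b
  exact add_mul _ _ _

theorem mulRight_mul (δ : doubleDerivation K B) (r s : Env K B) :
    mulRight δ (r * s) = mulRight (mulRight δ r) s := by
  ext b
  exact (mul_assoc _ _ _).symm

theorem mulRight_inner (r s : Env K B) :
    mulRight (inner K B r) s = inner K B (r * s) := by
  ext b
  rw [mulRight_apply, inner_apply, inner_apply, sub_mul, mul_assoc, mul_assoc]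

end doubleDerivation

theorem QuiverArrow.eq_toDouble_or_eq_star {V : Type v} [Quiver.{w} V]
    (β : QuiverArrow (Quiver.Symmetrify V)) :
    (∃ α : QuiverArrow V, β = α.toDouble) ∨ ∃ α : QuiverArrow V, β = α.star := by
  obtain ⟨a, b, h | h⟩ := β
  · exact Or.inl ⟨⟨a, b, h⟩, rfl⟩
  · exact Or.inr ⟨⟨b, a, h⟩, rfl⟩

/-- The skew group algebra of a preprojective algebra. -/
abbrev SkewPreprojectiveAlgebra (K : Type u) (V : Type v) (G : Type x) [CommRing K] [Quiver.{w} V]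
    [Fintype V] [∀ a b : V, Fintype (a ⟶ b)] [Group G] [QuiverAction G V] : Type (max u v w x) :=
  SkewMonoidAlgebra (PreprojectiveAlgebra K V) G

/-! ### Universal property of the skew group algebra of the preprojective algebra -/

namespace SkewPreprojectiveAlgebra

open PathAlgebra SkewMonoidAlgebra

variable (K : Type u) (V : Type v) (G : Type x) [CommRing K] [Quiver.{w} V] [Fintype V]
  [∀ a b : V, Fintype (a ⟶ b)] [Group G] [QuiverAction G V]

/-- The canonical homomorphism from the path algebra of the double quiver. -/
def ofDouble : PathAlgebra K (Quiver.Symmetrify V) →ₐ[K] SkewPreprojectiveAlgebra K V G :=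
  (incl K _ G).comp ((TwoSidedIdeal.span {preprojectiveRelation K V}).ringCon.mkₐ K)

variable {K V G}

theorem grp_mul_ofDouble (g : G) (a : PathAlgebra K (Quiver.Symmetrify V)) :
    grp (PreprojectiveAlgebra K V) g * ofDouble K V G a =
      ofDouble K V G (g • a) * grp (PreprojectiveAlgebra K V) g :=
  grp_mul_incl (K := K) g _

theorem ofDouble_preprojectiveRelation :
    ofDouble K V G (preprojectiveRelation K V) = 0 := by
  have h : ((TwoSidedIdeal.span {preprojectiveRelation K V}).ringCon.mkₐ K)
      (preprojectiveRelation K V) = 0 :=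
    (RingCon.eq _).2 ((TwoSidedIdeal.mem_iff _ _).1 (TwoSidedIdeal.subset_span rfl))
  exact (congrArg (incl K _ G) h).trans (map_zero _)

theorem algHom_ext {C : Type*} [Ring C] [Algebra K C]
    {F F' : SkewPreprojectiveAlgebra K V G →ₐ[K] C}
    (h : F.comp (ofDouble K V G) = F'.comp (ofDouble K V G))
    (hg : ∀ g, F (grp _ g) = F' (grp _ g)) : F = F' := by
  refine algHom_ext_incl (fun a => ?_) hg
  obtain ⟨a, rfl⟩ := RingCon.mk'_surjective _ a
  exact congr($h a)

section Lift

variable {C : Type*} [Ring C] [Algebra K C] {f : PathAlgebra K (Quiver.Symmetrify V) →ₐ[K] C}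
  {u : G →* C}

theorem ringCon_le_ker (hf : f (preprojectiveRelation K V) = 0) :
    (TwoSidedIdeal.span {preprojectiveRelation K V}).ringCon ≤ RingCon.ker f.toRingHom := by
  have h : TwoSidedIdeal.span {preprojectiveRelation K V} ≤ TwoSidedIdeal.ker f.toRingHom := by
    rw [TwoSidedIdeal.span_le, Set.singleton_subset_iff]
    exact (TwoSidedIdeal.mem_ker f.toRingHom).2 hf
  intro a b hab
  exact (TwoSidedIdeal.rel_iff _ a b).1 hab |> @h _ |> (TwoSidedIdeal.rel_iff _ a b).2

theorem liftₐ_smul_comm (hf : f (preprojectiveRelation K V) = 0)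
    (hu : ∀ (g : G) a, f (g • a) * u g = u g * f a) {a : PreprojectiveAlgebra K V} {g : G} :
    RingCon.liftₐ _ f (ringCon_le_ker hf) (g • a) * u g =
      u g * RingCon.liftₐ _ f (ringCon_le_ker hf) a := by
  obtain ⟨a, rfl⟩ := RingCon.mk'_surjective _ a
  exact hu g a

/-- The universal property of the skew group algebra of a preprojective algebra. -/
def lift (hf : f (preprojectiveRelation K V) = 0)
    (hu : ∀ (g : G) a, f (g • a) * u g = u g * f a) : SkewPreprojectiveAlgebra K V G →ₐ[K] C :=
  liftNCAlgHom (RingCon.liftₐ _ f (ringCon_le_ker hf)) u (liftₐ_smul_comm hf hu)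

theorem lift_ofDouble (hf : f (preprojectiveRelation K V) = 0)
    (hu : ∀ (g : G) a, f (g • a) * u g = u g * f a) (a : PathAlgebra K (Quiver.Symmetrify V)) :
    lift hf hu (ofDouble K V G a) = f a :=
  liftNCAlgHom_incl _ u (liftₐ_smul_comm hf hu) _

theorem lift_grp (hf : f (preprojectiveRelation K V) = 0)
    (hu : ∀ (g : G) a, f (g • a) * u g = u g * f a) (g : G) :
    lift hf hu (grp _ g) = u g :=
  liftNCAlgHom_grp _ u (liftₐ_smul_comm hf hu) g

end Lift

end SkewPreprojectiveAlgebra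

/-! ### Pairing of double derivations with the inverse arrows -/

namespace SkewPathAlgebra

open PathAlgebra SkewMonoidAlgebra SkewPreprojectiveAlgebra Env

variable {K : Type u} {V : Type v} {G : Type x} [CommRing K] [Quiver.{w} V] [Fintype V]
  [∀ a b : V, Fintype (a ⟶ b)] [Group G] [QuiverAction G V]

variable (K V G) in
/-- The canonical homomorphism to the skew group algebra of the preprojective algebra. -/
def toPreprojective : SkewPathAlgebra K V G →ₐ[K] SkewPreprojectiveAlgebra K V G :=
  lift K (e := fun i : V => ofDouble K V G (vertex K (V := Quiver.Symmetrify V) i))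
    (a := fun α => ofDouble K V G (ofArrow K α.toDouble)) (u := grp _)
    (fun i => by
      rw [← map_mul]
      exact congrArg _ (vertex_mul_self (V := Quiver.Symmetrify V) i))
    (fun i j h => by
      rw [← map_mul]
      exact (congrArg _ (vertex_mul_of_ne (V := Quiver.Symmetrify V) h)).trans (map_zero _))
    ((map_sum (ofDouble K V G) _ _).symm.trans (map_one (ofDouble K V G)))
    (fun α => by
      rw [← map_mul]
      exact congrArg _ (ofArrow_mul_vertex α.toDouble))
    (fun α => by
      rw [← map_mul]
      exact congrArg _ (vertex_mul_ofArrow α.toDouble))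
    (fun g i => by
      rw [grp_mul_ofDouble]
      exact congrArg (fun x => ofDouble K V G x * _)
        (smul_vertex (V := Quiver.Symmetrify V) g i).symm)
    (fun g α => by rw [grp_mul_ofDouble, smul_ofArrow, QuiverArrow.smul_toDouble])

theorem toPreprojective_vtx (i : V) : toPreprojective K V G (vtx K G i) =
    ofDouble K V G (vertex K (V := Quiver.Symmetrify V) i) :=
  lift_vtx ..

theorem toPreprojective_arr (α : QuiverArrow V) : toPreprojective K V G (arr K G α) =
    ofDouble K V G (ofArrow K α.toDouble) :=
  lift_arr ..

theorem toPreprojective_gp (g : G) : toPreprojective K V G (gp K V G g) = grp _ g :=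
  lift_gp ..

variable (K V G) in
/-- The additive map from double derivations to the skew group algebra of the preprojective
algebra. -/
def pairing : doubleDerivation K (SkewPathAlgebra K V G) →+ SkewPreprojectiveAlgebra K V G :=
  AddMonoidHom.mk' (fun δ => ∑ α : QuiverArrow V, sandwich (toPreprojective K V G)
    (ofDouble K V G (ofArrow K α.star)) (proj K V G (δ.1 (arr K G α)))) fun δ ε => by
    simp only [Submodule.coe_add, LinearMap.add_apply, map_add, Finset.sum_add_distrib]

theorem pairing_apply (δ : doubleDerivation K (SkewPathAlgebra K V G)) : pairing K V G δ =
    ∑ α : QuiverArrow V, sandwich (toPreprojective K V G)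
      (ofDouble K V G (ofArrow K α.star)) (proj K V G (δ.1 (arr K G α))) := rfl

/-- The factors α ⊗ 1 and 1 ⊗ α move into the sandwiched element, so that the sum over all arrows
sandwiches the negative of the preprojective relation. -/
theorem pairing_inner (r : Env K (SkewPathAlgebra K V G)) :
    pairing K V G (doubleDerivation.inner K _ r) = 0 := by
  have h : ∀ α : QuiverArrow V, sandwich (toPreprojective K V G)
      (ofDouble K V G (ofArrow K α.star)) (proj K V G
        ((doubleDerivation.inner K _ r).1 (arr K G α))) =
      sandwich (toPreprojective K V G) (ofDouble K V G
        (ofArrow K α.star * ofArrow K α.toDouble - ofArrow K α.toDouble * ofArrow K α.star))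
        (proj K V G r) := by
    intro α
    rw [doubleDerivation.inner_apply, map_sub, proj_right_mul, arr, proj_incl_mul, map_sub,
      sandwich_left_mul, sandwich_right_mul, ← arr, toPreprojective_arr, map_sub, sandwich_sub,
      map_mul, map_mul]
  rw [pairing_apply, Finset.sum_congr rfl fun α _ => h α, sum_sandwich, ← _root_.map_sum]
  have h0 : (∑ α : QuiverArrow V, (ofArrow K α.star * ofArrow K α.toDouble -
      ofArrow K α.toDouble * ofArrow K α.star)) = -preprojectiveRelation K V := by
    rw [preprojectiveRelation, ← Finset.sum_neg_distrib]
    simp_rw [neg_sub]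
  rw [h0, map_neg, ofDouble_preprojectiveRelation, neg_zero, sandwich_zero]

theorem pairing_mulRight_right (δ : doubleDerivation K (SkewPathAlgebra K V G))
    (b : SkewPathAlgebra K V G) : pairing K V G (doubleDerivation.mulRight δ (right K b)) =
      toPreprojective K V G b * pairing K V G δ := by
  simp only [pairing_apply, doubleDerivation.mulRight_apply, proj_mul_right, sandwich_mul_right,
    Finset.mul_sum]

theorem pairing_mulRight_left_incl (δ : doubleDerivation K (SkewPathAlgebra K V G))
    (a : PathAlgebra K V) :
    pairing K V G (doubleDerivation.mulRight δ (left K (incl K _ G a))) =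
      pairing K V G δ * toPreprojective K V G (incl K _ G a) := by
  simp only [pairing_apply, doubleDerivation.mulRight_apply, proj_mul_incl, sandwich_mul_left,
    Finset.sum_mul]

/-- Here `proj` gives no termwise linearity. After removing an inner part, equivariance of the
values makes the term of α on the left equal to the term of g α on the right, using g α^* g⁻¹ = (g
α)^*. -/
theorem pairing_mulRight_left_gp [Fintype G] (δ : doubleDerivation K (SkewPathAlgebra K V G))
    (g : G) : pairing K V G (doubleDerivation.mulRight δ (left K (gp K V G g))) =
      pairing K V G δ * toPreprojective K V G (gp K V G g) := by
  obtain ⟨r, ε, rfl, -, hg⟩ := exists_normalized δ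
  rw [doubleDerivation.mulRight_add, doubleDerivation.mulRight_inner, map_add, map_add,
    pairing_inner, pairing_inner, add_zero, add_zero, pairing_apply, pairing_apply,
    Finset.sum_mul]
  refine Fintype.sum_bijective (g • · : QuiverArrow V → QuiverArrow V)
    (MulAction.bijective g) _ _ fun α => ?_
  have h1 : left K (gp K V G g) * ε.1 (arr K G α) =
      right K (gp K V G g) * ε.1 (arr K G (g • α)) := by
    rw [← conj_mul_apply hg g α, ← mul_assoc, right_gp_mul_conj]
  -- Written as a conjugate by g⁻¹, so that `proj_conj` applies.
  have h2 : ε.1 (arr K G α) * left K (gp K V G g) = left K (gp K V G g⁻¹) *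
      (right K (gp K V G g) * ε.1 (arr K G (g • α))) * left K (gp K V G g⁻¹⁻¹) := by
    rw [← h1, ← mul_assoc, ← map_mul, gp_inv_mul, map_one, one_mul, inv_inv]
  rw [doubleDerivation.mulRight_apply, h2, proj_conj, sandwich_mul_left, sandwich_left_mul,
    proj_right_mul, sandwich_right_mul, toPreprojective_gp, toPreprojective_gp, inv_inv,
    ← mul_assoc, grp_mul_ofDouble, smul_ofArrow, QuiverArrow.smul_star, mul_assoc, grp_mul_inv,
    mul_one, toPreprojective_gp]

theorem pairing_mulRight_left [Fintype G] (δ : doubleDerivation K (SkewPathAlgebra K V G))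
    (b : SkewPathAlgebra K V G) : pairing K V G (doubleDerivation.mulRight δ (left K b)) =
      pairing K V G δ * toPreprojective K V G b := by
  let S : Subalgebra K (SkewPathAlgebra K V G) :=
    -- The quantifier over all derivations is needed for closure under products, where the condition
    -- for b is used at δ multiplied by a.
    { carrier := {b | ∀ δ, pairing K V G (doubleDerivation.mulRight δ (left K b)) =
        pairing K V G δ * toPreprojective K V G b}
      mul_mem' := fun {a b} ha hb δ => by
        rw [map_mul, doubleDerivation.mulRight_mul, hb, ha, map_mul, mul_assoc]
      add_mem' := fun {a b} ha hb δ => by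
        have h : doubleDerivation.mulRight δ (left K (a + b)) =
            doubleDerivation.mulRight δ (left K a) + doubleDerivation.mulRight δ (left K b) := by
          ext c
          rw [map_add]
          exact mul_add _ _ _
        rw [h, map_add, ha, hb, map_add, mul_add]
      algebraMap_mem' := fun c δ => by
        have h : left K (algebraMap K (SkewPathAlgebra K V G) c) =
            right K (algebraMap K (SkewPathAlgebra K V G) c) := by
          rw [Algebra.algebraMap_eq_smul_one, map_smul, map_smul, map_one, right_one]
        rw [h, pairing_mulRight_right, AlgHom.commutes, Algebra.commutes] }
  have hS : S = ⊤ := SkewMonoidAlgebra.subalgebra_eq_top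
    (fun a δ => pairing_mulRight_left_incl δ a) fun g δ => pairing_mulRight_left_gp δ g
  have hb : b ∈ S := hS ▸ Algebra.mem_top
  exact hb δ

theorem ker_toExt_le :
    (doubleDerivation.toExt K (SkewPathAlgebra K V G)).ker ≤ (pairing K V G).ker := by
  intro δ hδ
  obtain ⟨r, rfl⟩ := (doubleDerivation.toExt_eq_zero_iff δ).1 hδ
  exact pairing_inner r

variable (K V G) in
/-- The additive map from the extension bimodule to the skew group algebra of the preprojective
algebra. -/
def extPairing : ExtBimodule K (SkewPathAlgebra K V G) 1 →+ SkewPreprojectiveAlgebra K V G :=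
  (doubleDerivation.toExt K (SkewPathAlgebra K V G)).liftOfSurjective
    doubleDerivation.toExt_surjective ⟨pairing K V G, ker_toExt_le⟩

theorem extPairing_toExt (δ : doubleDerivation K (SkewPathAlgebra K V G)) :
    extPairing K V G (doubleDerivation.toExt K _ δ) = pairing K V G δ :=
  AddMonoidHom.liftOfRightInverse_comp_apply _ _ _ ⟨pairing K V G, ker_toExt_le⟩ δ

variable (K V G) in
/-- The homomorphism from the tensor algebra of the extension bimodule to the skew group algebra
of the preprojective algebra. -/
def ofTensorAlgebra [Fintype G] :
    BimoduleTensorAlgebra K (SkewPathAlgebra K V G) (ExtBimodule K (SkewPathAlgebra K V G) 1) →ₐ[K]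
      SkewPreprojectiveAlgebra K V G :=
  BimoduleTensorAlgebra.lift (toPreprojective K V G) (extPairing K V G)
    (fun b m => by
      obtain ⟨δ, rfl⟩ := doubleDerivation.toExt_surjective m
      rw [← doubleDerivation.toExt_mulRight_right, extPairing_toExt, extPairing_toExt,
        pairing_mulRight_right])
    (fun b m => by
      obtain ⟨δ, rfl⟩ := doubleDerivation.toExt_surjective m
      rw [← doubleDerivation.toExt_mulRight_left, extPairing_toExt, extPairing_toExt,
        pairing_mulRight_left])

theorem ofTensorAlgebra_ofRing [Fintype G] (b : SkewPathAlgebra K V G) :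
    ofTensorAlgebra K V G (BimoduleTensorAlgebra.ofRing K _ _ b) = toPreprojective K V G b :=
  BimoduleTensorAlgebra.lift_ofRing ..

theorem ofTensorAlgebra_ofModule [Fintype G]
    (δ : doubleDerivation K (SkewPathAlgebra K V G)) :
    ofTensorAlgebra K V G (BimoduleTensorAlgebra.ofModule K _ _ (doubleDerivation.toExt K _ δ)) =
      pairing K V G δ :=
  (BimoduleTensorAlgebra.lift_ofModule ..).trans (extPairing_toExt δ)

theorem pairing_dual [Fintype G] (α : QuiverArrow V) :
    pairing K V G (dual K G α) = ofDouble K V G (ofArrow K α.star) := by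
  classical
  rw [pairing_apply, Finset.sum_eq_single α]
  · rw [proj_dual_arr, if_pos rfl, idem, sandwich_apply, toPreprojective_vtx,
      toPreprojective_vtx, ← map_mul, ← map_mul]
    refine congrArg _ ?_
    exact (congrArg (· * _) (vertex_mul_ofArrow α.star)).trans (ofArrow_mul_vertex α.star)
  · intro β _ hβ
    rw [proj_dual_arr, if_neg hβ.symm, map_zero]
  · simp

end SkewPathAlgebra

/-! ### The homomorphism to the tensor algebra -/

namespace SkewPathAlgebra

open PathAlgebra SkewMonoidAlgebra SkewPreprojectiveAlgebra Env BimoduleTensorAlgebra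

open doubleDerivation hiding map_mul map_one ext

variable (K : Type u) (V : Type v) (G : Type x) [CommRing K] [Quiver.{w} V] [Fintype V]
  [Group G] [QuiverAction G V]

/-- The tensor algebra of the first extension bimodule. -/
abbrev ExtTensorAlgebra : Type (max u v w x) :=
  BimoduleTensorAlgebra K (SkewPathAlgebra K V G) (ExtBimodule K (SkewPathAlgebra K V G) 1)

variable {K V G}

/-- The class of a double derivation in the tensor algebra. -/
def extClass (δ : doubleDerivation K (SkewPathAlgebra K V G)) : ExtTensorAlgebra K V G :=
  ofModule K _ _ (toExt K _ δ)

variable (K V G) in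
/-- The homomorphism from the group to the tensor algebra. -/
def ofGroup : G →* ExtTensorAlgebra K V G :=
  (ofRing K (SkewPathAlgebra K V G) (ExtBimodule K (SkewPathAlgebra K V G) 1) :
    SkewPathAlgebra K V G →* ExtTensorAlgebra K V G).comp (gp K V G)

theorem extClass_mulRight_left (δ : doubleDerivation K (SkewPathAlgebra K V G))
    (b : SkewPathAlgebra K V G) :
    extClass (mulRight δ (left K b)) = extClass δ * ofRing K _ _ b := by
  rw [extClass, toExt_mulRight_left, ofModule_op_smul, extClass]

theorem extClass_mulRight_right (δ : doubleDerivation K (SkewPathAlgebra K V G))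
    (b : SkewPathAlgebra K V G) :
    extClass (mulRight δ (right K b)) = ofRing K _ _ b * extClass δ := by
  rw [extClass, toExt_mulRight_right, ofModule_smul, extClass]

theorem extClass_add (δ ε : doubleDerivation K (SkewPathAlgebra K V G)) :
    extClass (δ + ε) = extClass δ + extClass ε := by
  simp only [extClass, map_add]

theorem extClass_inner (r : Env K (SkewPathAlgebra K V G)) :
    extClass (inner K _ r) = 0 := by
  rw [extClass, (toExt_eq_zero_iff _).2 ⟨r, rfl⟩, map_zero]

theorem extClass_sum {ι : Type*} (s : Finset ι)
    (δ : ι → doubleDerivation K (SkewPathAlgebra K V G)) :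
    extClass (∑ i ∈ s, δ i) = ∑ i ∈ s, extClass (δ i) := by
  simp only [extClass, _root_.map_sum]

theorem extClass_sub (δ ε : doubleDerivation K (SkewPathAlgebra K V G)) :
    extClass (δ - ε) = extClass δ - extClass ε := by
  rw [extClass, _root_.map_sub (toExt K _), _root_.map_sub (ofModule K _ _), extClass, extClass]

/-- The inner bimodule structure swaps sides: right multiplication by a ⊗ b acts on the class as b
from the left and a from the right. -/
theorem extClass_mulRight (δ : doubleDerivation K (SkewPathAlgebra K V G))
    (r : Env K (SkewPathAlgebra K V G)) :
    extClass (mulRight δ r) = sandwich (ofRing K _ _) (extClass δ) r := by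
  induction r using Env.induction with
  | h a b => rw [← right_mul_left, mulRight_mul, extClass_mulRight_left, extClass_mulRight_right,
      right_mul_left, sandwich_apply]
  | hadd r s hr hs =>
    have h : mulRight δ (r + s) = mulRight δ r + mulRight δ s := by
      ext b
      exact mul_add _ _ _
    rw [h, extClass_add, hr, hs, map_add]

variable [Fintype G]

/-- The images of the arrows of the double quiver in the tensor algebra. -/
def doubleArrow : QuiverArrow (Quiver.Symmetrify V) → ExtTensorAlgebra K V G
  | ⟨a, b, Sum.inl α⟩ => ofRing K _ _ (arr K G (⟨a, b, α⟩ : QuiverArrow V))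
  | ⟨a, b, Sum.inr α⟩ => extClass (dual K G (⟨b, a, α⟩ : QuiverArrow V))

theorem doubleArrow_toDouble (α : QuiverArrow V) :
    (doubleArrow α.toDouble : ExtTensorAlgebra K V G) = ofRing K _ _ (arr K G α) := rfl

theorem doubleArrow_star (α : QuiverArrow V) :
    (doubleArrow α.star : ExtTensorAlgebra K V G) = extClass (dual K G α) := rfl

theorem doubleArrow_mul_vtx (β : QuiverArrow (Quiver.Symmetrify V)) :
    (doubleArrow β : ExtTensorAlgebra K V G) * ofRing K _ _ (vtx K G (V := V) β.src) =
      doubleArrow β := by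
  obtain ⟨α, rfl⟩ | ⟨α, rfl⟩ := β.eq_toDouble_or_eq_star
  · rw [doubleArrow_toDouble, ← map_mul]
    exact congrArg _ (arr_mul_vtx α)
  · rw [doubleArrow_star, ← extClass_mulRight_left]
    exact congrArg _ (dual_mulRight_left_vtx α)

theorem vtx_mul_doubleArrow (β : QuiverArrow (Quiver.Symmetrify V)) :
    ofRing K _ _ (vtx K G (V := V) β.tgt) * (doubleArrow β : ExtTensorAlgebra K V G) =
      doubleArrow β := by
  obtain ⟨α, rfl⟩ | ⟨α, rfl⟩ := β.eq_toDouble_or_eq_star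
  · rw [doubleArrow_toDouble, ← map_mul]
    exact congrArg _ (vtx_mul_arr α)
  · rw [doubleArrow_star, ← extClass_mulRight_right]
    exact congrArg _ (dual_mulRight_right_vtx α)

theorem doubleArrow_smul (g : G) (β : QuiverArrow (Quiver.Symmetrify V)) :
    (doubleArrow (g • β) : ExtTensorAlgebra K V G) * ofRing K _ _ (gp K V G g) =
      ofRing K _ _ (gp K V G g) * doubleArrow β := by
  obtain ⟨α, rfl⟩ | ⟨α, rfl⟩ := β.eq_toDouble_or_eq_star
  · rw [QuiverArrow.smul_toDouble, doubleArrow_toDouble, doubleArrow_toDouble, ← map_mul,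
      ← map_mul, gp_mul_arr]
  · rw [QuiverArrow.smul_star, doubleArrow_star, doubleArrow_star, ← extClass_mulRight_left,
      ← extClass_mulRight_right, dual_mulRight_gp]

variable (K V G) in
/-- The homomorphism from the path algebra of the double quiver to the tensor algebra. -/
def ofDoublePath : PathAlgebra K (Quiver.Symmetrify V) →ₐ[K] ExtTensorAlgebra K V G :=
  PathAlgebra.lift K (V := Quiver.Symmetrify V) (e := fun i => ofRing K _ _ (vtx K G (V := V) i))
    (a := doubleArrow) (fun i => by
      rw [← map_mul]
      exact congrArg _ (vtx_mul_self (V := V) i))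
    (fun i j h => by
      rw [← map_mul]
      exact (congrArg _ (vtx_mul_of_ne (V := V) h)).trans (map_zero _))
    ((_root_.map_sum (ofRing K _ _) _ _).symm.trans
      ((congrArg _ (sum_vtx (V := V))).trans (map_one _)))
    vtx_mul_doubleArrow

theorem ofDoublePath_vertex (i : V) :
    ofDoublePath K V G (vertex K (V := Quiver.Symmetrify V) i) = ofRing K _ _ (vtx K G i) :=
  lift_vertex ..

theorem ofDoublePath_ofArrow (β : QuiverArrow (Quiver.Symmetrify V)) :
    ofDoublePath K V G (ofArrow K β) = doubleArrow β :=
  lift_ofArrow _ _ _ _ (doubleArrow_mul_vtx β)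

theorem ofDoublePath_smul (g : G) (a : PathAlgebra K (Quiver.Symmetrify V)) :
    ofDoublePath K V G (g • a) * ofRing K _ _ (gp K V G g) =
      ofRing K _ _ (gp K V G g) * ofDoublePath K V G a := by
  have hv : ∀ (g : G) (i : V), ofDoublePath K V G (vertex K (V := Quiver.Symmetrify V)
      ((QuiverAction.act g : V ⥤q V).obj i)) * ofRing K _ _ (gp K V G g) =
      ofRing K _ _ (gp K V G g) * ofDoublePath K V G (vertex K (V := Quiver.Symmetrify V) i) := by
    intro g i
    rw [ofDoublePath_vertex, ofDoublePath_vertex, ← map_mul, ← map_mul, gp_mul_vtx]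
  refine smul_comm_of_generators (f := ofDoublePath K V G)
    (u := ofGroup K V G)
    (fun g i => ?_) (fun g β => ?_)
  · exact (congrArg (fun x => ofDoublePath K V G x * ofGroup K V G g)
      (smul_vertex (V := Quiver.Symmetrify V) g i)).trans (hv g i)
  · rw [smul_ofArrow, ofDoublePath_ofArrow, ofDoublePath_ofArrow]
    exact doubleArrow_smul g β

variable [∀ a b : V, Fintype (a ⟶ b)]

theorem ofDoublePath_preprojectiveRelation :
    ofDoublePath K V G (preprojectiveRelation K V) = 0 := by
  -- The zero on the right is replaced by the class of the inner derivation that equals the sum of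
  -- commutators.
  rw [preprojectiveRelation, _root_.map_sum, ← extClass_inner (-casimir K V G),
    ← sum_dual_commutator, extClass_sum]
  refine Finset.sum_congr rfl fun α _ => ?_
  rw [map_sub, map_mul, map_mul, ofDoublePath_ofArrow, ofDoublePath_ofArrow, doubleArrow_toDouble,
    doubleArrow_star, extClass_sub, extClass_mulRight_left, extClass_mulRight_right]

variable (K V G) in
/-- The homomorphism from the skew group algebra of the preprojective algebra to the tensor
algebra. -/
def toTensorAlgebra : SkewPreprojectiveAlgebra K V G →ₐ[K] ExtTensorAlgebra K V G :=
  SkewPreprojectiveAlgebra.lift (f := ofDoublePath K V G)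
    (u := ofGroup K V G)
    ofDoublePath_preprojectiveRelation ofDoublePath_smul

theorem toTensorAlgebra_ofDouble (a : PathAlgebra K (Quiver.Symmetrify V)) :
    toTensorAlgebra K V G (ofDouble K V G a) = ofDoublePath K V G a :=
  lift_ofDouble ..

theorem toTensorAlgebra_grp (g : G) :
    toTensorAlgebra K V G (grp _ g) = ofRing K _ _ (gp K V G g) :=
  lift_grp ..

theorem toTensorAlgebra_toPreprojective (b : SkewPathAlgebra K V G) :
    toTensorAlgebra K V G (toPreprojective K V G b) = ofRing K _ _ b := by
  have h : (toTensorAlgebra K V G).comp (toPreprojective K V G) = ofRing K _ _ := by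
    refine SkewPathAlgebra.algHom_ext (fun i => ?_) (fun α => ?_) (fun g => ?_)
    · rw [AlgHom.comp_apply, toPreprojective_vtx, toTensorAlgebra_ofDouble, ofDoublePath_vertex]
    · rw [AlgHom.comp_apply, toPreprojective_arr, toTensorAlgebra_ofDouble, ofDoublePath_ofArrow,
        doubleArrow_toDouble]
    · rw [AlgHom.comp_apply, toPreprojective_gp, toTensorAlgebra_grp]
  exact congr($h b)

theorem toTensorAlgebra_sandwich (p : SkewPreprojectiveAlgebra K V G)
    (r : Env K (SkewPathAlgebra K V G)) :
    toTensorAlgebra K V G (sandwich (toPreprojective K V G) p r) =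
      sandwich (ofRing K _ _) (toTensorAlgebra K V G p) r := by
  induction r using Env.induction with
  | h a b => rw [sandwich_apply, sandwich_apply, map_mul, map_mul,
      toTensorAlgebra_toPreprojective, toTensorAlgebra_toPreprojective]
  | hadd r s hr hs => rw [map_add, map_add, map_add, hr, hs]

/-- Both sides ignore inner derivations, so δ may be normalized; expanding it in the dual
derivations then matches the two sums term by term. -/
theorem toTensorAlgebra_pairing (δ : doubleDerivation K (SkewPathAlgebra K V G)) :
    toTensorAlgebra K V G (pairing K V G δ) = extClass δ := by
  obtain ⟨r, ε, rfl, hv, hg⟩ := exists_normalized δ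
  rw [map_add, pairing_inner, add_zero, extClass_add, extClass_inner, add_zero]
  conv_rhs => rw [← sum_dual_mulRight_proj hv hg, extClass_sum]
  rw [pairing_apply, _root_.map_sum]
  refine Finset.sum_congr rfl fun α _ => ?_
  rw [toTensorAlgebra_sandwich, toTensorAlgebra_ofDouble, ofDoublePath_ofArrow, doubleArrow_star,
    extClass_mulRight]

theorem ofTensorAlgebra_comp_toTensorAlgebra :
    (ofTensorAlgebra K V G).comp (toTensorAlgebra K V G) = AlgHom.id K _ := by
  have h : ((ofTensorAlgebra K V G).comp (toTensorAlgebra K V G)).comp (ofDouble K V G) =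
      (AlgHom.id K _).comp (ofDouble K V G) := by
    refine PathAlgebra.algHom_ext (V := Quiver.Symmetrify V) (fun i => ?_) fun β => ?_
    · change ofTensorAlgebra K V G (toTensorAlgebra K V G (ofDouble K V G _)) = ofDouble K V G _
      rw [toTensorAlgebra_ofDouble]
      refine (congrArg (ofTensorAlgebra K V G) (ofDoublePath_vertex (V := V) i)).trans ?_
      exact (ofTensorAlgebra_ofRing _).trans (toPreprojective_vtx (V := V) i)
    · change ofTensorAlgebra K V G (toTensorAlgebra K V G (ofDouble K V G _)) = ofDouble K V G _
      rw [toTensorAlgebra_ofDouble, ofDoublePath_ofArrow]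
      obtain ⟨α, rfl⟩ | ⟨α, rfl⟩ := β.eq_toDouble_or_eq_star
      · rw [doubleArrow_toDouble, ofTensorAlgebra_ofRing, toPreprojective_arr]
      · rw [doubleArrow_star, extClass, ofTensorAlgebra_ofModule, pairing_dual]
  refine SkewPreprojectiveAlgebra.algHom_ext h fun g => ?_
  rw [AlgHom.comp_apply, toTensorAlgebra_grp, ofTensorAlgebra_ofRing, toPreprojective_gp,
    AlgHom.id_apply]

theorem toTensorAlgebra_comp_ofTensorAlgebra :
    (toTensorAlgebra K V G).comp (ofTensorAlgebra K V G) = AlgHom.id K _ := by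
  refine BimoduleTensorAlgebra.hom_ext (fun b => ?_) fun m => ?_
  · rw [AlgHom.comp_apply, ofTensorAlgebra_ofRing, toTensorAlgebra_toPreprojective,
      AlgHom.id_apply]
  · obtain ⟨δ, rfl⟩ := toExt_surjective m
    rw [AlgHom.comp_apply, ofTensorAlgebra_ofModule, toTensorAlgebra_pairing, AlgHom.id_apply,
      extClass]

variable (K V G) in
/-- The skew group algebra of the preprojective algebra is the tensor algebra of the first
extension bimodule of the skew group algebra of the path algebra. -/
def equivTensorAlgebra : SkewPreprojectiveAlgebra K V G ≃ₐ[K] ExtTensorAlgebra K V G :=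
  AlgEquiv.ofAlgHom (toTensorAlgebra K V G) (ofTensorAlgebra K V G)
    toTensorAlgebra_comp_ofTensorAlgebra ofTensorAlgebra_comp_toTensorAlgebra

end SkewPathAlgebra

end

theorem proposition3p11 {K : Type u} [Field K] {V : Type v} [Quiver.{w} V] [Fintype V]
    [∀ a b : V, Fintype (a ⟶ b)] {G : Type x} [Group G] [Finite G] [QuiverAction G V] :
    Nonempty (SkewMonoidAlgebra (PreprojectiveAlgebra K V) G ≃ₐ[K]
      HigherPreprojectiveAlgebra K (SkewMonoidAlgebra (PathAlgebra K V) G) 2) := by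
  have := Fintype.ofFinite G
  -- The degree `2 - 1` of the extension bimodule reduces to `1` by definition.
  exact ⟨SkewPathAlgebra.equivTensorAlgebra K V G⟩
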